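/- Consider an access point serving two clients $j\in\{1,2\}$ in slots $t=1,2,\dots$ (frame length $\tau=1$). In every slot each client has one fresh packet, and the access point may attempt at most one client; an attempted packet of client $j$ is delivered with probability $p_j\in(0,1]$, independently of everything known before the transmission, and undelivered packets are dropped at the end of the slot. Let $u_j(t)$ and $g_j(t)$ be the indicators that client $j$ is attempted, respectively that a packet of client $j$ is delivered, in slot $t$. Let $(\mathcal F_t)_{t\ge 0}$ be a filtration such that the (possibly randomized, history dependent) choice of the client for slot $t$ is $\mathcal F_{t-1}$-measurable, the deliveries in slot $t$ are $\mathcal F_t$-measurable, and the channel in slot $t$ is independent of $\mathcal F_{t-1}$. Let $q_1,q_2\ge 0$ satisfy $\frac{q_1}{p_1}+\frac{q_2}{p_2}=1$ (heavy traffic). Assume that the policy is non-idling, i.e. almost surely some client is attempted in every slot, and that it fulfils $(q_1,q_2)$, i.e. almost surely $\liminf_{T\to\infty}\frac1T\sum_{t=1}^T g_j(t)\ge q_j$ for $j=1,2$. Put $$m_j(t)=u_j(t)-\frac{1}{p_j}g_j(t),\qquad M_j(t)=\sum_{l=1}^t m_j(l),\qquad \mathcal S_j^2(T)=\sum_{t=1}^T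 E\big(m_j^2(t)\,\big|\,\mathcal F_{t-1}\big),$$ $$v_j=\frac{1-p_j}{p_j},\qquad c_j=\frac{q_j}{p_j}v_j=\frac{q_j(1-p_j)}{p_j^2},\qquad \phi(t)=\sqrt{2t\log\log t}.$$ Then, for $j=1,2$, $M_j$ is a martingale with respect to $(\mathcal F_t)$, and, almost surely, (i) $E(m_j^2(t)\mid\mathcal F_{t-1})=u_j(t)\,v_j$ for every $t\ge 1$; (ii) $\mathcal S_j^2(T)=\sum_{t=1}^T u_j(t)\,v_j$ for every $T$; (iii) $\lim_{T\to\infty}\mathcal S_j^2(T)/T=c_j$; (iv) $\lim_{T\to\infty}\mathcal S_j(T)/\sqrt T=\sqrt{c_j}$, where $\mathcal S_j(T)=\sqrt{\mathcal S_j^2(T)}$. Consequently, almost surely, $\displaystyle\limsup_{t\to\infty}\frac{M_j(t)}{\phi(t)}=\sqrt{c_j}$. -/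

import Mathlib

open MeasureTheory ProbabilityTheory Filter Topology

noncomputable section

/-- An access point serving two clients with frames of one slot, under some scheduling policy.
Slots are numbered `1, 2, 3, …`. In every slot each client has one fresh packet, at most one packet
is transmitted, and a packet for client `j` that is transmitted in slot `t` is delivered exactly
when the channel of client `j` is good in that slot, which has probability `p j`, independently of
everything known before the transmission.

The σ-algebra `ℱ t` is what is known after slot `t` and before the transmission in slot `t + 1`,
including any private randomness that the policy uses to choose the client of slot `t + 1`. -/
structure ScheduledSystem {Ω : Type*} [mΩ : MeasurableSpace Ω] (P : Measure Ω)
    (p : Fin 2 → ℝ) where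
  /-- the information available to the policy -/
  ℱ : Filtration ℕ mΩ
  /-- the client attempted in a slot (`none` if the access point idles) -/
  serve : ℕ → Ω → Option (Fin 2)
  /-- the event that the channel of a client is good in a slot -/
  good : ℕ → Fin 2 → Set Ω
  /-- the choice for slot `t + 1` is made on the basis of `ℱ t` -/
  serve_predictable : ∀ t j, MeasurableSet[ℱ t] {ω | serve (t + 1) ω = some j}
  good_measurable : ∀ t j, MeasurableSet (good (t + 1) j)
  good_prob : ∀ t j, P (good (t + 1) j) = ENNReal.ofReal (p j)
  /-- the channel in slot `t + 1` is independent of what is known before that transmission -/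
  good_indep : ∀ t j B, MeasurableSet[ℱ t] B → IndepSet (good (t + 1) j) B P
  /-- after slot `t + 1` it is known whether a packet has been delivered in it -/
  delivery_observed : ∀ t j,
    MeasurableSet[ℱ (t + 1)] ({ω | serve (t + 1) ω = some j} ∩ good (t + 1) j)

namespace ScheduledSystem

variable {Ω : Type*} [mΩ : MeasurableSpace Ω] {P : Measure Ω} {p : Fin 2 → ℝ}

/-- `u_j(t)`: the indicator that client `j` is attempted in slot `t`. -/
def u (S : ScheduledSystem P p) (j : Fin 2) (t : ℕ) : Ω → ℝ :=
  {ω | S.serve t ω = some j}.indicator 1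

/-- `g_j(t)`: the indicator that a packet of client `j` is delivered in slot `t`. -/
def g (S : ScheduledSystem P p) (j : Fin 2) (t : ℕ) : Ω → ℝ :=
  ({ω | S.serve t ω = some j} ∩ S.good t j).indicator 1

/-- `m_j(t) = u_j(t) - g_j(t) / p_j`. -/
def m (S : ScheduledSystem P p) (j : Fin 2) (t : ℕ) (ω : Ω) : ℝ :=
  S.u j t ω - (1 / p j) * S.g j t ω

/-- `M_j(t) = ∑_{l=1}^t m_j(l)`. -/
def M (S : ScheduledSystem P p) (j : Fin 2) (t : ℕ) (ω : Ω) : ℝ :=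
  ∑ l ∈ Finset.Icc 1 t, S.m j l ω

/-- `S_j²(T) = ∑_{t=1}^T E[m_j(t)² | ℱ_{t-1}]`, the conditional variance sum. -/
def condVarSum (S : ScheduledSystem P p) (j : Fin 2) (T : ℕ) (ω : Ω) : ℝ :=
  ∑ t ∈ Finset.Icc 1 T, (P[fun ω' => S.m j t ω' ^ 2 | S.ℱ (t - 1)]) ω

/-- Each client has a fresh packet in every slot, so a policy is non-idling exactly when it attempts
some client in every slot. -/
def NonIdling (S : ScheduledSystem P p) : Prop :=
  ∀ t, 1 ≤ t → ∀ᵐ ω ∂P, S.serve t ω ≠ none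

/-- Almost surely, the timely throughput of each client `j` is at least `q j`. -/
def Fulfils (S : ScheduledSystem P p) (q : Fin 2 → ℝ) : Prop :=
  ∀ j, ∀ᵐ ω ∂P, q j ≤ liminf (fun T : ℕ => (∑ t ∈ Finset.Icc 1 T, S.g j t ω) / (T : ℝ)) atTop

end ScheduledSystem

/-- `φ(t) = √(2 t log log t)`. -/
def lilScale (t : ℕ) : ℝ := Real.sqrt (2 * t * Real.log (Real.log t))

end

/-!
Let `N_j(t)` be the number of attempts of client `j` up to slot `t`. With `Λ` the cumulant
generating function of one increment of `M_j`, the process `exp (r M_j - Λ(r) N_j)` is a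
martingale, and `Λ(r) ~ r² v_j / 2` as `r → 0`. Doob's maximal inequality for it, applied along
geometric blocks of slots with the optimal `r` in each block, shows that eventually
`|M_j(t)| ≤ b φ(t)` for every `b > √(a v_j)`, provided that eventually `N_j(t) ≤ a t`. With `a = 1`
this gives `M_j(t) / t → 0`: a client with throughput at least `q_j` is attempted at a rate of at
least `q_j / p_j`, and under heavy traffic this leaves `N_j(t) / t → q_j / p_j` as the only
possibility. This limit determines the conditional variances, and with `a` slightly larger than
`q_j / p_j` it gives the upper half of the law of the iterated logarithm.

For the lower half, if `q_j > 0` then client `j` is attempted infinitely often, and the outcomes of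
its successive attempts are independent and identically distributed whatever the policy does. Hence
`M_j(t)` is the sum of `N_j(t)` terms of an i.i.d. sequence, to which the classical argument
applies: sharp lower bounds for the tails, obtained by exponential tilting, and the second
Borel–Cantelli lemma along geometric blocks. Finally `φ(N_j(t)) / φ(t) → √(q_j / p_j)`.
-/

lemma tendsto_log_add_one_atTop : Tendsto (fun k : ℕ => Real.log ((k : ℝ) + 1)) atTop atTop :=
  Real.tendsto_log_atTop.comp (tendsto_natCast_atTop_atTop.atTop_add tendsto_const_nhds)

lemma tendsto_log_add_one_div_pow {θ : ℝ} (hθ : 1 < θ) :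
    Tendsto (fun k : ℕ => Real.log ((k : ℝ) + 1) / θ ^ k) atTop (𝓝 0) := by
  have hθ0 : 0 < θ := one_pos.trans hθ
  refine squeeze_zero (fun k => ?_) (fun k => ?_) (tendsto_pow_const_div_const_pow_of_one_lt 1 hθ)
  · exact div_nonneg (Real.log_nonneg (by linarith [k.cast_nonneg (α := ℝ)])) (by positivity)
  · rw [pow_one]
    gcongr
    linarith [Real.log_le_sub_one_of_pos (by positivity : (0 : ℝ) < (k : ℝ) + 1)]

lemma tendsto_log_div_log {α : Type*} {l : Filter α} {f g : α → ℝ} {c : ℝ} (hc : 0 < c)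
    (hf : Tendsto f l atTop) (h : Tendsto (fun x => g x / f x) l (𝓝 c)) :
    Tendsto (fun x => Real.log (g x) / Real.log (f x)) l (𝓝 1) := by
  have hlogf : Tendsto (fun x => Real.log (f x)) l atTop := Real.tendsto_log_atTop.comp hf
  have hratio : Tendsto (fun x => 1 + Real.log (g x / f x) / Real.log (f x)) l (𝓝 (1 + 0)) :=
    tendsto_const_nhds.add ((h.log hc.ne').div_atTop hlogf)
  rw [add_zero] at hratio
  refine hratio.congr' ?_
  filter_upwards [hf.eventually_gt_atTop 0, hlogf.eventually_gt_atTop 0,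
    h.eventually_const_lt hc] with x hfx hlx hgx
  have hg : g x ≠ 0 := fun h0 => by simp [h0] at hgx
  rw [Real.log_div hg hfx.ne']
  field_simp
  ring

lemma tendsto_log_natCast_mul_div_log_add_one {c : ℝ} (hc : 0 < c) :
    Tendsto (fun k : ℕ => Real.log (k * c) / Real.log ((k : ℝ) + 1)) atTop (𝓝 1) := by
  refine tendsto_log_div_log hc (tendsto_natCast_atTop_atTop.atTop_add tendsto_const_nhds) ?_
  have h := (tendsto_natCast_div_add_atTop (𝕜 := ℝ) 1).mul_const c
  rw [one_mul] at h
  exact h.congr fun k => by ring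

lemma tendsto_log_log_natCast :
    Tendsto (fun t : ℕ => Real.log (Real.log (t : ℝ))) atTop atTop :=
  (Real.tendsto_log_atTop.comp Real.tendsto_log_atTop).comp tendsto_natCast_atTop_atTop

lemma eventually_log_add_one_le_mul_log_log {θ : ℝ} (hθ : 1 < θ) :
    ∀ᶠ k : ℕ in atTop, ∀ t : ℝ, θ ^ k ≤ t → Real.log (k + 1) ≤ θ * Real.log (Real.log t) := by
  have hlogθ : 0 < Real.log θ := Real.log_pos hθ
  have hlt : θ⁻¹ < 1 := inv_lt_one_of_one_lt₀ hθ
  filter_upwards [(tendsto_log_natCast_mul_div_log_add_one hlogθ).eventually_const_lt hlt,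
    tendsto_log_add_one_atTop.eventually_gt_atTop 0, eventually_ge_atTop 1] with k hk hpos hk1 t ht
  have hk0 : (0 : ℝ) < k := by exact_mod_cast hk1
  have hlog : k * Real.log θ ≤ Real.log t := by
    rw [← Real.log_pow]
    exact Real.log_le_log (by positivity) ht
  have hloglog := Real.log_le_log (by positivity) hlog
  rw [lt_div_iff₀ hpos, inv_mul_lt_iff₀ (by positivity)] at hk
  exact hk.le.trans (by gcongr)

lemma lilScale_nonneg (t : ℕ) : 0 ≤ lilScale t :=
  Real.sqrt_nonneg _

lemma eventually_lilScale_pos : ∀ᶠ t : ℕ in atTop, 0 < lilScale t := by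
  filter_upwards [tendsto_log_log_natCast.eventually_gt_atTop 0, eventually_gt_atTop 0] with t h ht
  have : (0 : ℝ) < t := by exact_mod_cast ht
  exact Real.sqrt_pos.2 (by positivity)

lemma tendsto_lilScale_div_lilScale {N : ℕ → ℕ} {r : ℝ} (hr : 0 < r)
    (hN : Tendsto (fun t => (N t : ℝ) / t) atTop (𝓝 r)) :
    Tendsto (fun t => lilScale (N t) / lilScale t) atTop (𝓝 (√r)) := by
  have hlog := tendsto_log_div_log hr tendsto_natCast_atTop_atTop hN
  have hloglog := tendsto_log_div_log one_pos
    (Real.tendsto_log_atTop.comp tendsto_natCast_atTop_atTop) hlog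
  have h := (hN.mul hloglog).sqrt
  rw [mul_one] at h
  refine h.congr' ?_
  filter_upwards [tendsto_log_log_natCast.eventually_gt_atTop 0] with t ht
  rw [lilScale, lilScale, ← Real.sqrt_div' _ (by positivity)]
  congr 1
  simp only [Function.comp_apply]
  rw [mul_assoc, mul_assoc, mul_div_mul_left _ _ two_ne_zero, mul_div_mul_comm]

lemma tendsto_lilScale_div : Tendsto (fun t : ℕ => lilScale t / t) atTop (𝓝 0) := by
  have hlog : Tendsto (fun x : ℝ => Real.log x / x) atTop (𝓝 0) :=
    Real.isLittleO_log_id_atTop.tendsto_div_nhds_zero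
  have hsqrt : Tendsto (fun t : ℕ => √(2 * (Real.log t / t))) atTop (𝓝 0) := by
    simpa using ((hlog.comp tendsto_natCast_atTop_atTop).const_mul 2).sqrt
  refine squeeze_zero' (Eventually.of_forall fun t => div_nonneg (lilScale_nonneg t)
    t.cast_nonneg) ?_ hsqrt
  filter_upwards [(Real.tendsto_log_atTop.comp tendsto_natCast_atTop_atTop).eventually_gt_atTop 0,
    eventually_gt_atTop 0] with t (hlt : 0 < Real.log t) ht
  have ht0 : (0 : ℝ) < t := by exact_mod_cast ht
  have hll : Real.log (Real.log t) ≤ Real.log t :=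
    (Real.log_le_sub_one_of_pos hlt).trans (by simp)
  rw [lilScale, div_le_iff₀ ht0]
  refine Real.sqrt_le_iff.2 ⟨by positivity, ?_⟩
  rw [mul_pow, Real.sq_sqrt (mul_nonneg zero_le_two (div_nonneg hlt.le ht0.le))]
  calc 2 * (t : ℝ) * Real.log (Real.log t) ≤ 2 * t * Real.log t := by gcongr
    _ = 2 * (Real.log t / t) * t ^ 2 := by field_simp

lemma tendsto_lilScale_pow_div {K : ℕ} (hK : 1 < K) :
    Tendsto (fun k : ℕ => lilScale (K ^ (k + 1)) / √(2 * (K : ℝ) ^ (k + 1) * Real.log (k + 1)))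
      atTop (𝓝 1) := by
  have hlogK : 0 < Real.log K := Real.log_pos (by exact_mod_cast hK)
  have hlog : Tendsto (fun k : ℕ => Real.log (((k : ℝ) + 1) * Real.log K) / Real.log (k + 1))
      atTop (𝓝 1) := by
    have hk : Tendsto (fun k : ℕ => (k : ℝ) + 1) atTop atTop :=
      tendsto_natCast_atTop_atTop.atTop_add tendsto_const_nhds
    refine tendsto_log_div_log hlogK hk (tendsto_const_nhds.congr fun k => ?_)
    field_simp
  have h := hlog.sqrt
  rw [Real.sqrt_one] at h
  refine h.congr' ?_
  filter_upwards [tendsto_log_add_one_atTop.eventually_gt_atTop 0] with k hk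
  have hK0 : (0 : ℝ) < K := by exact_mod_cast one_pos.trans hK
  rw [lilScale, ← Real.sqrt_div' _ (by positivity)]
  congr 1
  push_cast
  rw [Real.log_pow, mul_div_mul_left _ _ (by positivity)]
  push_cast
  rfl

section BorelCantelli

variable {Ω : Type*} [mΩ : MeasurableSpace Ω] {P : Measure Ω}

lemma ae_eventually_notMem_of_summable [IsFiniteMeasure P] {E : ℕ → Set Ω} {b : ℕ → ℝ}
    (hb : Summable b) (h : ∀ᶠ k in atTop, P.real (E k) ≤ b k) :
    ∀ᵐ ω ∂P, ∀ᶠ k in atTop, ω ∉ E k := by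
  have hsum : Summable fun k => P.real (E k) := by
    refine Summable.of_norm_bounded_eventually_nat hb ?_
    filter_upwards [h] with k hk
    rwa [Real.norm_of_nonneg measureReal_nonneg]
  refine ae_eventually_notMem ?_
  simpa [ofReal_measureReal] using hsum.tsum_ofReal_ne_top

lemma ae_frequently_mem_of_iIndepSet {E : ℕ → Set Ω} {b : ℕ → ℝ}
    (hE : ∀ k, MeasurableSet (E k)) (hind : iIndepSet E P) (hb0 : ∀ k, 0 ≤ b k)
    (hb : ¬Summable b) (h : ∀ᶠ k in atTop, b k ≤ P.real (E k)) :
    ∀ᵐ ω ∂P, ∃ᶠ k in atTop, ω ∈ E k := by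
  have := hind.isProbabilityMeasure
  have htop : ∑' k, P (E k) = ⊤ := by
    by_contra hne
    refine hb (Summable.of_norm_bounded_eventually_nat (ENNReal.summable_toReal hne) ?_)
    filter_upwards [h] with k hk
    rwa [Real.norm_of_nonneg (hb0 k)]
  have hlimsup : ∀ᵐ ω ∂P, ω ∈ limsup E atTop :=
    (prob_compl_eq_zero_iff (MeasurableSet.measurableSet_limsup hE)).2
      (measure_limsup_eq_one hE hind htop)
  filter_upwards [hlimsup] with ω hω
  exact mem_limsup_iff_frequently_mem.1 hω

lemma iIndepSet_of_forall_lt [IsProbabilityMeasure P] {E : ℕ → Set Ω}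
    (hE : ∀ k, MeasurableSet (E k))
    (h : ∀ (k : ℕ) (s : Finset ℕ), (∀ i ∈ s, i < k) →
      P (E k ∩ ⋂ i ∈ s, E i) = P (E k) * P (⋂ i ∈ s, E i)) :
    iIndepSet E P := by
  rw [iIndepSet_iff_meas_biInter hE]
  intro s
  induction s using Finset.induction_on_max with
  | empty => simp
  | insert k s hk ih =>
    have hks : k ∉ s := fun hks => lt_irrefl _ (hk k hks)
    rw [Finset.prod_insert hks, Finset.set_biInter_insert, h k s hk, ih]

lemma iIndepSet_of_measurableSet_iSup_Ico {m : ℕ → MeasurableSpace Ω} (hm : ∀ i, m i ≤ mΩ)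
    (hind : iIndep m P) {n : ℕ → ℕ} (hn : Monotone n) {E : ℕ → Set Ω}
    (hE : ∀ k, MeasurableSet[⨆ i ∈ Set.Ico (n k) (n (k + 1)), m i] (E k)) :
    iIndepSet E P := by
  have := hind.isProbabilityMeasure
  refine iIndepSet_of_forall_lt (fun k => (iSup₂_le fun i _ => hm i) _ (hE k)) fun k s hs => ?_
  have hmeas : ∀ l (A : Set ℕ), Set.Ico (n l) (n (l + 1)) ⊆ A →
      MeasurableSet[⨆ i ∈ A, m i] (E l) := fun l A hA =>
    (biSup_mono hA : _ ≤ ⨆ i ∈ A, m i) _ (hE l)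
  have hdisj : Disjoint (Set.Ici (n k)) (Set.Iio (n k)) :=
    Set.disjoint_left.2 fun i hi hi' => absurd (Set.mem_Iio.1 hi') (not_lt.2 hi)
  refine (Indep_iff _ _ _).1 (indep_iSup_of_disjoint hm hind hdisj) _ _
    (hmeas k _ fun i hi => hi.1) (Finset.measurableSet_biInter _ fun l hl => ?_)
  exact hmeas l _ fun i hi => hi.2.trans_le (hn (hs l hl))

lemma iIndepSet_le_sum_Ico {f : ℕ → Ω → ℝ} (hf : ∀ i, Measurable (f i)) (hind : iIndepFun f P)
    {n : ℕ → ℕ} (hn : Monotone n) (x : ℕ → ℝ) :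
    iIndepSet (fun k => {ω | x k ≤ ∑ i ∈ Finset.Ico (n k) (n (k + 1)), f i ω}) P := by
  refine iIndepSet_of_measurableSet_iSup_Ico (fun i => (hf i).comap_le) hind hn fun k => ?_
  refine measurableSet_le measurable_const (Finset.measurable_sum _ fun i hi => ?_)
  exact (comap_measurable (f i)).mono (le_iSup₂_of_le i (Finset.mem_Ico.1 hi) le_rfl) le_rfl

lemma ae_limsup_div_eq {X : ℕ → Ω → ℝ} {φ : ℕ → ℝ} {c : ℝ} (hφ : ∀ᶠ t in atTop, 0 < φ t)
    (hupper : ∀ b, c < b → ∀ᵐ ω ∂P, ∀ᶠ t in atTop, X t ω ≤ b * φ t)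
    (hlower : ∀ b < c, ∀ᵐ ω ∂P, ∃ᶠ t in atTop, b * φ t ≤ X t ω) :
    ∀ᵐ ω ∂P, limsup (fun t => ((X t ω / φ t : ℝ) : EReal)) atTop = (c : EReal) := by
  obtain ⟨a, -, ha, hac⟩ := exists_seq_strictMono_tendsto c
  obtain ⟨b, -, hb, hbc⟩ := exists_seq_strictAnti_tendsto c
  have htendsto : Tendsto ((↑) : ℝ → EReal) (𝓝 c) (𝓝 c) := continuous_coe_real_ereal.tendsto c
  filter_upwards [ae_all_iff.2 fun n => hupper (b n) (hb n),
    ae_all_iff.2 fun n => hlower (a n) (ha n)] with ω hω_upper hω_lower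
  apply le_antisymm
  · refine ge_of_tendsto' (htendsto.comp hbc) fun n => limsup_le_of_le (h := ?_)
    filter_upwards [hω_upper n, hφ] with t ht hφt
    exact EReal.coe_le_coe_iff.2 ((div_le_iff₀ hφt).2 ht)
  · refine le_of_tendsto' (htendsto.comp hac) fun n => le_limsup_of_frequently_le
      (((hω_lower n).and_eventually hφ).mono fun t ht => ?_)
    exact EReal.coe_le_coe_iff.2 ((le_div_iff₀ ht.2).2 ht.1)

end BorelCantelli

section MomentGeneratingFunction

variable {Ω : Type*} [mΩ : MeasurableSpace Ω] {P : Measure Ω} {X : Ω → ℝ}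

lemma tilted_exponent_le {ε : ℝ} (hε : |ε| ≤ 1 / 2) :
    (1 - ε) ^ 2 * (1 + ε ^ 2 / 8) + 2 * ε * (1 - ε) ≤ (1 - ε ^ 2 / 8) - ε ^ 2 / 2 := by
  have h : (1 - ε) ^ 2 ≤ 3 := by nlinarith [abs_le.1 hε]
  nlinarith [mul_le_mul_of_nonneg_right h (sq_nonneg ε)]

lemma exp_le_one_div_four_mul_exp {a b : ℝ} (h : a + Real.log 4 ≤ b) :
    Real.exp a ≤ 1 / 4 * Real.exp b := by
  have := Real.exp_le_exp.2 h
  rw [Real.exp_add, Real.exp_log (by norm_num)] at this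
  linarith

lemma exp_mul_mgf_le_of_mgf_le {s ε x y : ℝ} (hε : |ε| ≤ 1 / 2) (hsx : s * x = 2 * y)
    (hy : 2 * Real.log 4 ≤ y * ε ^ 2) (hy0 : 0 ≤ y)
    (hmgf : mgf X P ((1 - ε) * s) ≤ Real.exp (y * ((1 - ε) ^ 2 * (1 + ε ^ 2 / 8)))) :
    Real.exp (ε * s * ((1 - ε) * x)) * mgf X P ((1 - ε) * s)
      ≤ 1 / 4 * Real.exp (y * (1 - ε ^ 2 / 8)) := by
  refine (mul_le_mul_of_nonneg_left hmgf (Real.exp_pos _).le).trans ?_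
  rw [← Real.exp_add]
  apply exp_le_one_div_four_mul_exp
  calc ε * s * ((1 - ε) * x) + y * ((1 - ε) ^ 2 * (1 + ε ^ 2 / 8)) + Real.log 4
      = y * ((1 - ε) ^ 2 * (1 + ε ^ 2 / 8) + 2 * ε * (1 - ε)) + Real.log 4 := by
        linear_combination ε * (1 - ε) * hsx
    _ ≤ y * (1 - ε ^ 2 / 8 - ε ^ 2 / 2) + y * ε ^ 2 / 2 := by
        gcongr
        · exact tilted_exponent_le hε
        · linarith
    _ = y * (1 - ε ^ 2 / 8) := by ring

variable [IsProbabilityMeasure P]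

lemma tendsto_cgf_div_sq (h0 : 0 ∈ interior (integrableExpSet X P)) (hmean : P[X] = 0) :
    Tendsto (fun s => cgf X P s / s ^ 2) (𝓝[≠] 0) (𝓝 (Var[X; P] / 2)) := by
  have hderiv0 : deriv (cgf X P) 0 = 0 := by simp [deriv_cgf_zero h0, hmean]
  have hvar : deriv (deriv (cgf X P)) 0 = Var[X; P] := by
    have h := iteratedDeriv_two_cgf_eq_integral h0
    rw [hderiv0, iteratedDeriv_succ, iteratedDeriv_one] at h
    simpa [variance_of_integral_eq_zero
      (aemeasurable_of_mem_interior_integrableExpSet h0) hmean] using h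
  have hanalytic := analyticAt_cgf h0
  refine HasDerivAt.lhopital_zero_nhdsNE (f' := deriv (cgf X P)) (g' := fun s => 2 * s)
    ?_ ?_ ?_ ?_ ?_ ?_
  · filter_upwards [hanalytic.eventually_analyticAt.filter_mono nhdsWithin_le_nhds] with s hs
    exact hs.differentiableAt.hasDerivAt
  · exact Eventually.of_forall fun s => by simpa using hasDerivAt_pow 2 s
  · filter_upwards [self_mem_nhdsWithin] with s hs
    exact mul_ne_zero two_ne_zero hs
  · simpa using hanalytic.continuousAt.tendsto.mono_left nhdsWithin_le_nhds
  · exact ((continuous_pow 2).tendsto' 0 0 (by simp)).mono_left nhdsWithin_le_nhds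
  · have h := (hasDerivAt_iff_tendsto_slope_zero.1
      hanalytic.deriv.differentiableAt.hasDerivAt).div_const 2
    rw [hvar] at h
    refine h.congr fun s => ?_
    simp only [zero_add, hderiv0, sub_zero, smul_eq_mul]
    rw [inv_mul_eq_div, div_div, mul_comm s]

lemma eventually_mgf_le_exp (h0 : 0 ∈ interior (integrableExpSet X P)) (hmean : P[X] = 0)
    {w : ℝ} (hw : Var[X; P] < w) :
    ∀ᶠ s in 𝓝 0, mgf X P s ≤ Real.exp (s ^ 2 * w / 2) := by
  have h := (tendsto_cgf_div_sq h0 hmean).eventually_lt_const (div_lt_div_of_pos_right hw two_pos)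
  filter_upwards [eventually_nhdsWithin_iff.1 h, mem_interior_iff_mem_nhds.1 h0] with s hs hint
  rcases eq_or_ne s 0 with rfl | hs0
  · simp
  · have := (div_lt_iff₀ (by positivity)).1 (hs hs0)
    rw [← exp_cgf hint]
    exact Real.exp_le_exp.2 (by linarith)

lemma eventually_exp_le_mgf (h0 : 0 ∈ interior (integrableExpSet X P)) (hmean : P[X] = 0)
    {w : ℝ} (hw : w < Var[X; P]) :
    ∀ᶠ s in 𝓝 0, Real.exp (s ^ 2 * w / 2) ≤ mgf X P s := by
  have h := (tendsto_cgf_div_sq h0 hmean).eventually_const_lt (div_lt_div_of_pos_right hw two_pos)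
  filter_upwards [eventually_nhdsWithin_iff.1 h, mem_interior_iff_mem_nhds.1 h0] with s hs hint
  rcases eq_or_ne s 0 with rfl | hs0
  · simp
  · have := (lt_div_iff₀ (by positivity)).1 (hs hs0)
    rw [← exp_cgf hint]
    exact Real.exp_le_exp.2 (by linarith)

lemma exp_mul_le_add_add {s δ a b : ℝ} (hs : 0 ≤ s) (hδ : 0 ≤ δ) (x : ℝ) :
    Real.exp (s * x) ≤ Real.exp (δ * s * a) * Real.exp ((1 - δ) * s * x)
      + Real.exp (s * b) * (Set.Ici a).indicator 1 x
      + Real.exp (-(δ * s * b)) * Real.exp ((1 + δ) * s * x) := by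
  have hlow := Real.exp_pos (δ * s * a + (1 - δ) * s * x)
  have hmid := Real.exp_pos (s * b)
  have hhigh := Real.exp_pos (-(δ * s * b) + (1 + δ) * s * x)
  have hδs : 0 ≤ δ * s := mul_nonneg hδ hs
  rw [← Real.exp_add, ← Real.exp_add]
  rcases lt_or_ge x a with hxa | hax
  · have : Real.exp (s * x) ≤ Real.exp (δ * s * a + (1 - δ) * s * x) :=
      Real.exp_le_exp.2 (by linarith [mul_le_mul_of_nonneg_left hxa.le hδs])
    rw [Set.indicator_of_notMem (Set.notMem_Ici.2 hxa)]
    linarith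
  · rw [Set.indicator_of_mem (Set.mem_Ici.2 hax), Pi.one_apply, mul_one]
    rcases le_total x b with hxb | hbx
    · have : Real.exp (s * x) ≤ Real.exp (s * b) :=
        Real.exp_le_exp.2 (mul_le_mul_of_nonneg_left hxb hs)
      linarith
    · have : Real.exp (s * x) ≤ Real.exp (-(δ * s * b) + (1 + δ) * s * x) :=
        Real.exp_le_exp.2 (by linarith [mul_le_mul_of_nonneg_left hbx hδs])
      linarith

lemma mgf_le_add_add (hX : AEMeasurable X P) {s δ : ℝ} (a b : ℝ) (hs : 0 ≤ s) (hδ : 0 ≤ δ)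
    (h : s ∈ integrableExpSet X P) (hlow : (1 - δ) * s ∈ integrableExpSet X P)
    (hhigh : (1 + δ) * s ∈ integrableExpSet X P) :
    mgf X P s ≤ Real.exp (δ * s * a) * mgf X P ((1 - δ) * s)
      + Real.exp (s * b) * P.real {ω | a ≤ X ω}
      + Real.exp (-(δ * s * b)) * mgf X P ((1 + δ) * s) := by
  have hIci : NullMeasurableSet {ω | a ≤ X ω} P := nullMeasurableSet_le aemeasurable_const hX
  have hmid : Integrable (fun ω => (Set.Ici a).indicator (1 : ℝ → ℝ) (X ω)) P :=
    (integrable_const (1 : ℝ)).indicator₀ hIci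
  have hprob : ∫ ω, (Set.Ici a).indicator (1 : ℝ → ℝ) (X ω) ∂P = P.real {ω | a ≤ X ω} :=
    (integral_indicator₀ (f := 1) hIci).trans (by simp)
  have hlow' := Integrable.const_mul hlow (Real.exp (δ * s * a))
  have hhigh' := Integrable.const_mul hhigh (Real.exp (-(δ * s * b)))
  have hsum := hlow'.add (hmid.const_mul (Real.exp (s * b)))
  refine (integral_mono h (hsum.add hhigh') fun ω =>
    exp_mul_le_add_add (a := a) (b := b) hs hδ (X ω)).trans_eq ?_
  rw [integral_add' hsum hhigh', integral_add' hlow' (hmid.const_mul _), integral_const_mul,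
    integral_const_mul, integral_const_mul, hprob]
  rfl

-- Under the measure tilted by `exp (s X)`, the variable `X` concentrates near `x = 2 y / s`;
-- tilting slightly less or slightly more shows that `X ∉ [(1 - δ) x, (1 + δ) x]` contributes at
-- most half of the moment generating function at `s`.
lemma exp_neg_le_measureReal_of_mgf (hX : AEMeasurable X P) {s δ y : ℝ} (hs : 0 < s) (hδ : 0 < δ)
    (hδ' : δ ≤ 1 / 2) (hy : 2 * Real.log 4 ≤ y * δ ^ 2)
    (hint : ∀ r, |r| ≤ 2 → r * s ∈ integrableExpSet X P)
    (hupper : ∀ r, |r| ≤ 2 → mgf X P (r * s) ≤ Real.exp (y * (r ^ 2 * (1 + δ ^ 2 / 8))))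
    (hlower : Real.exp (y * (1 - δ ^ 2 / 8)) ≤ mgf X P s) :
    Real.exp (-((1 + 4 * δ) * y)) ≤ P.real {ω | (1 - δ) * (2 * y / s) ≤ X ω} := by
  set x := 2 * y / s
  have hsx : s * x = 2 * y := mul_div_cancel₀ _ hs.ne'
  have hlog4 : 0 < Real.log 4 := Real.log_pos (by norm_num)
  have hy0 : 0 ≤ y := (pos_of_mul_pos_left (by linarith) (sq_nonneg δ)).le
  have hlow_mem : |1 - δ| ≤ 2 := abs_le.2 ⟨by linarith, by linarith⟩
  have hhigh_mem : |1 + δ| ≤ 2 := abs_le.2 ⟨by linarith, by linarith⟩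
  have hlow := exp_mul_mgf_le_of_mgf_le (ε := δ) (by rwa [abs_of_pos hδ]) hsx hy hy0
    (hupper _ hlow_mem)
  have hhigh := exp_mul_mgf_le_of_mgf_le (ε := -δ) (by rwa [abs_neg, abs_of_pos hδ]) hsx
    (by rwa [neg_sq]) hy0 (by simpa only [neg_sq, sub_neg_eq_add] using hupper _ hhigh_mem)
  rw [neg_sq, sub_neg_eq_add, neg_mul, neg_mul] at hhigh
  have hsplit := mgf_le_add_add hX ((1 - δ) * x) ((1 + δ) * x) hs.le hδ.le
    (by simpa using hint 1 (by norm_num)) (hint _ hlow_mem) (hint _ hhigh_mem)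
  have hmid : 1 / 2 * Real.exp (y * (1 - δ ^ 2 / 8))
      ≤ Real.exp (s * ((1 + δ) * x)) * P.real {ω | (1 - δ) * x ≤ X ω} := by linarith
  have hexp : Real.exp (s * ((1 + δ) * x)) * Real.exp (-((1 + 4 * δ) * y))
      ≤ 1 / 4 * Real.exp (y * (1 - δ ^ 2 / 8)) := by
    rw [← Real.exp_add]
    apply exp_le_one_div_four_mul_exp
    calc s * ((1 + δ) * x) + -((1 + 4 * δ) * y) + Real.log 4
        = y * (1 - 2 * δ) + Real.log 4 := by linear_combination (1 + δ) * hsx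
      _ ≤ y * (1 - δ ^ 2 / 8 - δ ^ 2 / 2) + y * δ ^ 2 / 2 := by
          have : 1 - 2 * δ ≤ 1 - δ ^ 2 / 8 - δ ^ 2 / 2 := by nlinarith
          exact add_le_add (mul_le_mul_of_nonneg_left this hy0) (by linarith)
      _ = y * (1 - δ ^ 2 / 8) := by ring
  refine le_of_mul_le_mul_left (hexp.trans (le_trans ?_ hmid)) (Real.exp_pos _)
  linarith [Real.exp_pos (y * (1 - δ ^ 2 / 8))]

end MomentGeneratingFunction

section IIDSums

open scoped Finset

variable {Ω ι : Type*} [mΩ : MeasurableSpace Ω] {P : Measure Ω} {X : ι → Ω → ℝ} {Y : Ω → ℝ}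

lemma mgf_sum_eq_pow (hX : ∀ i, Measurable (X i)) (hind : iIndepFun X P)
    (hid : ∀ i, IdentDistrib (X i) Y P P) (t : Finset ι) (r : ℝ) :
    mgf (∑ i ∈ t, X i) P r = mgf Y P r ^ #t := by
  rw [hind.mgf_sum hX,
    Finset.prod_congr rfl fun i _ => congrFun (mgf_congr_identDistrib (hid i)) r, Finset.prod_const]

lemma integrableExpSet_subset_integrableExpSet_sum (hX : ∀ i, Measurable (X i))
    (hind : iIndepFun X P) (hid : ∀ i, IdentDistrib (X i) Y P P) (t : Finset ι) :
    integrableExpSet Y P ⊆ integrableExpSet (∑ i ∈ t, X i) P := by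
  have := hind.isProbabilityMeasure
  intro r hr
  refine hind.integrable_exp_mul_sum hX fun i _ => ?_
  exact ((hid i).comp (u := fun x => Real.exp (r * x)) (by fun_prop)).integrable_iff.2 hr

lemma eventually_forall_abs_le_mul {A : ℝ → Prop} (hA : ∀ᶠ s in 𝓝 0, A s) {c : ℝ} (hc : 0 < c) :
    ∀ᶠ s in 𝓝 0, ∀ r, |r| ≤ c → A (r * s) := by
  obtain ⟨ε, hε, hball⟩ := Metric.eventually_nhds_iff.1 hA
  refine Metric.eventually_nhds_iff.2 ⟨ε / c, by positivity, fun s hs r hr => hball ?_⟩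
  rw [dist_zero_right, Real.norm_eq_abs] at hs ⊢
  rw [abs_mul]
  calc |r| * |s| ≤ c * |s| := by gcongr
    _ < ε := by rwa [lt_div_iff₀' hc] at hs

lemma eventually_exp_neg_le_measureReal_sum (hX : ∀ i, Measurable (X i)) (hind : iIndepFun X P)
    (hid : ∀ i, IdentDistrib (X i) Y P P) (h0 : 0 ∈ interior (integrableExpSet Y P))
    (hmean : P[Y] = 0) (hvar : 0 < Var[Y; P]) {δ : ℝ} (hδ : 0 < δ) (hδ' : δ ≤ 1 / 2) :
    ∀ᶠ s in 𝓝[>] 0, ∀ t : Finset ι, 2 * Real.log 4 ≤ #t * s ^ 2 * Var[Y; P] / 2 * δ ^ 2 →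
      Real.exp (-((1 + 4 * δ) * (#t * s ^ 2 * Var[Y; P] / 2)))
        ≤ P.real {ω | (1 - δ) * (#t * s * Var[Y; P]) ≤ ∑ i ∈ t, X i ω} := by
  have := hind.isProbabilityMeasure
  have hδ2 : 0 < δ ^ 2 / 8 := by positivity
  have hupper := eventually_forall_abs_le_mul
    ((eventually_mgf_le_exp h0 hmean (w := Var[Y; P] * (1 + δ ^ 2 / 8)) (by nlinarith)).and
      (mem_interior_iff_mem_nhds.1 h0)) two_pos
  have hlower := eventually_exp_le_mgf h0 hmean (w := Var[Y; P] * (1 - δ ^ 2 / 8)) (by nlinarith)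
  filter_upwards [hupper.filter_mono nhdsWithin_le_nhds, hlower.filter_mono nhdsWithin_le_nhds,
    self_mem_nhdsWithin] with s hs_upper hs_lower hs t ht
  have hs0 : s ≠ 0 := (Set.mem_Ioi.1 hs).ne'
  have hpow (x : ℝ) : Real.exp (#t * x) = Real.exp x ^ #t := Real.exp_nat_mul x _
  have hx : #t * s * Var[Y; P] = 2 * (#t * s ^ 2 * Var[Y; P] / 2) / s := by field_simp
  rw [hx]
  simp only [← Finset.sum_apply]
  refine exp_neg_le_measureReal_of_mgf (Finset.aemeasurable_sum t fun i _ => (hX i).aemeasurable)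
    hs hδ hδ' ht (fun r hr => ?_) (fun r hr => ?_) ?_
  · exact integrableExpSet_subset_integrableExpSet_sum hX hind hid t (hs_upper r hr).2
  · rw [mgf_sum_eq_pow hX hind hid]
    refine (pow_le_pow_left₀ mgf_nonneg (hs_upper r hr).1 _).trans_eq ?_
    rw [← hpow]
    ring_nf
  · rw [mgf_sum_eq_pow hX hind hid]
    refine Eq.trans_le ?_ (pow_le_pow_left₀ (Real.exp_pos _).le hs_lower _)
    rw [← hpow]
    ring_nf

lemma eventually_measureReal_sum_le_exp_neg (hX : ∀ i, Measurable (X i)) (hind : iIndepFun X P)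
    (hid : ∀ i, IdentDistrib (X i) Y P P) (h0 : 0 ∈ interior (integrableExpSet Y P))
    (hmean : P[Y] = 0) (hvar : 0 < Var[Y; P]) :
    ∀ᶠ s in 𝓝[>] 0, ∀ t : Finset ι,
      P.real {ω | ∑ i ∈ t, X i ω ≤ -(2 * (#t * s * Var[Y; P]))}
        ≤ Real.exp (-(#t * s ^ 2 * Var[Y; P])) := by
  have := hind.isProbabilityMeasure
  have hmgf := eventually_forall_abs_le_mul
    ((eventually_mgf_le_exp h0 hmean (w := 2 * Var[Y; P]) (by linarith)).and
      (mem_interior_iff_mem_nhds.1 h0)) one_pos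
  filter_upwards [hmgf.filter_mono nhdsWithin_le_nhds, self_mem_nhdsWithin] with s hs_mgf hs t
  obtain ⟨hle, hint⟩ := hs_mgf (-1) (by norm_num)
  have hs0 : -1 * s ≤ 0 := by linarith [Set.mem_Ioi.1 hs]
  simp only [← Finset.sum_apply]
  refine (measure_le_le_exp_mul_mgf _ hs0
    (integrableExpSet_subset_integrableExpSet_sum hX hind hid t hint)).trans ?_
  rw [mgf_sum_eq_pow hX hind hid]
  refine (mul_le_mul_of_nonneg_left (pow_le_pow_left₀ mgf_nonneg hle _)
    (Real.exp_pos _).le).trans_eq ?_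
  rw [← Real.exp_nat_mul, ← Real.exp_add]
  ring_nf

lemma exists_le_one_sub_div_sqrt {κ : ℝ} (hκ : κ < 1) :
    ∃ δ, 0 < δ ∧ δ ≤ 1 / 2 ∧ κ ≤ (1 - δ) / √(1 + 4 * δ) := by
  have htendsto : Tendsto (fun δ : ℝ => (1 - δ) / √(1 + 4 * δ)) (𝓝[>] 0) (𝓝 1) := by
    have : ContinuousAt (fun δ : ℝ => (1 - δ) / √(1 + 4 * δ)) 0 := by
      refine ContinuousAt.div (by fun_prop) (by fun_prop) (by simp)
    simpa using this.tendsto.mono_left nhdsWithin_le_nhds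
  have hsmall : ∀ᶠ δ : ℝ in 𝓝[>] 0, δ ≤ 1 / 2 :=
    nhdsWithin_le_nhds (Iic_mem_nhds one_half_pos)
  obtain ⟨δ, ⟨hδ, hδ'⟩, hδκ⟩ := ((eventually_mem_nhdsWithin.and hsmall).and
    (htendsto.eventually_const_lt hκ)).exists
  exact ⟨δ, hδ, hδ', hδκ.le⟩

variable {α : Type*} {l : Filter α} {t : α → Finset ι} {y : α → ℝ}

lemma tendsto_sqrt_div_card_mul {v : ℝ} (hv : 0 < v) (ht : ∀ k, (t k).Nonempty)
    (hy : ∀ᶠ k in l, 0 < y k) (hyt : Tendsto (fun k => y k / #(t k)) l (𝓝 0)) :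
    Tendsto (fun k => √(2 * y k / (#(t k) * v))) l (𝓝[>] 0) := by
  refine tendsto_nhdsWithin_iff.2 ⟨?_, ?_⟩
  · have h := (hyt.const_mul (2 / v)).sqrt
    rw [mul_zero, Real.sqrt_zero] at h
    refine h.congr fun k => ?_
    rw [div_mul_div_comm, mul_comm v]
  · filter_upwards [hy] with k hk
    have : (0 : ℝ) < #(t k) := by exact_mod_cast (ht k).card_pos
    exact Real.sqrt_pos.2 (by positivity)

lemma mul_sqrt_div_mul {n v y : ℝ} (hn : 0 < n) (hv : 0 < v) :
    n * √(2 * y / (n * v)) * v = √(2 * n * v * y) := by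
  have hnv : 0 < n * v := mul_pos hn hv
  rw [mul_right_comm, ← Real.sqrt_sq hnv.le, ← Real.sqrt_mul (sq_nonneg _), Real.sqrt_sq hnv.le]
  congr 1
  field_simp

lemma eventually_exp_neg_le_measureReal_mul_sqrt_le_sum (hX : ∀ i, Measurable (X i))
    (hind : iIndepFun X P) (hid : ∀ i, IdentDistrib (X i) Y P P)
    (h0 : 0 ∈ interior (integrableExpSet Y P)) (hmean : P[Y] = 0) (hvar : 0 < Var[Y; P])
    (ht : ∀ k, (t k).Nonempty) (hy : Tendsto y l atTop)
    (hyt : Tendsto (fun k => y k / #(t k)) l (𝓝 0)) {κ : ℝ} (hκ : κ < 1) :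
    ∀ᶠ k in l, Real.exp (-y k)
      ≤ P.real {ω | κ * √(2 * #(t k) * Var[Y; P] * y k) ≤ ∑ i ∈ t k, X i ω} := by
  have := hind.isProbabilityMeasure
  obtain ⟨δ, hδ, hδ', hκδ⟩ := exists_le_one_sub_div_sqrt hκ
  have hδ4 : 0 < 1 + 4 * δ := by positivity
  have hy' := hy.atTop_div_const hδ4
  have hyt' : Tendsto (fun k => y k / (1 + 4 * δ) / #(t k)) l (𝓝 0) := by
    simpa [div_right_comm] using hyt.div_const (1 + 4 * δ)
  have hs := (tendsto_sqrt_div_card_mul hvar ht (hy'.eventually_gt_atTop 0) hyt').eventually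
    (eventually_exp_neg_le_measureReal_sum hX hind hid h0 hmean hvar hδ hδ')
  filter_upwards [hs, hy'.eventually_ge_atTop (2 * Real.log 4 / δ ^ 2), hy'.eventually_gt_atTop 0]
    with k hk hyk hyk0
  have ht0 : (0 : ℝ) < #(t k) := by exact_mod_cast (ht k).card_pos
  have hsq : #(t k) * √(2 * (y k / (1 + 4 * δ)) / (#(t k) * Var[Y; P])) ^ 2 * Var[Y; P] / 2
      = y k / (1 + 4 * δ) := by
    rw [Real.sq_sqrt (by positivity)]
    field_simp
  specialize hk (t k)
  rw [hsq, mul_sqrt_div_mul ht0 hvar, mul_div_cancel₀ _ hδ4.ne'] at hk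
  refine (hk ((div_le_iff₀ (by positivity)).1 hyk)).trans (measureReal_mono fun ω hω => ?_)
  refine le_trans ?_ (Set.mem_ofPred.1 hω)
  rw [← mul_div_assoc, Real.sqrt_div' _ hδ4.le, ← mul_div_assoc, ← div_mul_eq_mul_div]
  gcongr

lemma eventually_measureReal_sum_le_neg_two_mul_sqrt_le (hX : ∀ i, Measurable (X i))
    (hind : iIndepFun X P) (hid : ∀ i, IdentDistrib (X i) Y P P)
    (h0 : 0 ∈ interior (integrableExpSet Y P)) (hmean : P[Y] = 0) (hvar : 0 < Var[Y; P])
    (ht : ∀ k, (t k).Nonempty) (hy : ∀ᶠ k in l, 0 < y k)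
    (hyt : Tendsto (fun k => y k / #(t k)) l (𝓝 0)) :
    ∀ᶠ k in l, P.real {ω | ∑ i ∈ t k, X i ω ≤ -(2 * √(2 * #(t k) * Var[Y; P] * y k))}
      ≤ Real.exp (-(2 * y k)) := by
  have hs := (tendsto_sqrt_div_card_mul hvar ht hy hyt).eventually
    (eventually_measureReal_sum_le_exp_neg hX hind hid h0 hmean hvar)
  filter_upwards [hs, hy] with k hk hyk
  have ht0 : (0 : ℝ) < #(t k) := by exact_mod_cast (ht k).card_pos
  have hsq : #(t k) * √(2 * y k / (#(t k) * Var[Y; P])) ^ 2 * Var[Y; P] = 2 * y k := by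
    rw [Real.sq_sqrt (by positivity)]
    field_simp
  simpa only [hsq, mul_sqrt_div_mul ht0 hvar] using hk (t k)

end IIDSums

section IIDLowerBound

open scoped Finset

variable {Ω : Type*} [mΩ : MeasurableSpace Ω] {P : Measure Ω} {X : ℕ → Ω → ℝ} {Y : Ω → ℝ}

lemma tendsto_log_add_one_div_card_range {K : ℕ} (hK : 1 < K) :
    Tendsto (fun k : ℕ => Real.log (k + 1) / #(Finset.range (K ^ k))) atTop (𝓝 0) := by
  simpa using tendsto_log_add_one_div_pow (θ := K) (by exact_mod_cast hK)

lemma natCast_card_Ico_pow {K : ℕ} (hK : 0 < K) (k : ℕ) :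
    (#(Finset.Ico (K ^ k) (K ^ (k + 1))) : ℝ) = (1 - 1 / K) * (K : ℝ) ^ (k + 1) := by
  have hK' : (0 : ℝ) < K := by exact_mod_cast hK
  rw [Nat.card_Ico, Nat.cast_sub (Nat.pow_le_pow_right hK (k.le_add_right 1))]
  push_cast
  field_simp
  ring

lemma tendsto_log_add_one_div_card_Ico {K : ℕ} (hK : 1 < K) :
    Tendsto (fun k : ℕ => Real.log (k + 1) / #(Finset.Ico (K ^ k) (K ^ (k + 1)))) atTop (𝓝 0) := by
  have hK' : (1 : ℝ) < K := by exact_mod_cast hK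
  have h := (tendsto_log_add_one_div_pow hK').const_mul (1 / ((1 - 1 / K) * (K : ℝ)))
  rw [mul_zero] at h
  refine h.congr fun k => ?_
  rw [natCast_card_Ico_pow (one_pos.trans hK), div_mul_div_comm, one_mul, pow_succ']
  ring_nf

lemma ae_frequently_mul_sqrt_le_sum_Ico (hX : ∀ i, Measurable (X i)) (hind : iIndepFun X P)
    (hid : ∀ i, IdentDistrib (X i) Y P P) (h0 : 0 ∈ interior (integrableExpSet Y P))
    (hmean : P[Y] = 0) (hvar : 0 < Var[Y; P]) {K : ℕ} (hK : 1 < K) {κ : ℝ} (hκ : κ < 1) :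
    ∀ᵐ ω ∂P, ∃ᶠ k : ℕ in atTop,
      κ * √(2 * #(Finset.Ico (K ^ k) (K ^ (k + 1))) * Var[Y; P] * Real.log (k + 1))
        ≤ ∑ i ∈ Finset.Ico (K ^ k) (K ^ (k + 1)), X i ω := by
  have hmono : StrictMono (fun k => K ^ k) := pow_right_strictMono₀ hK
  refine ae_frequently_mem_of_iIndepSet (b := fun k => 1 / ((k : ℝ) + 1)) (fun k => ?_)
    (iIndepSet_le_sum_Ico hX hind hmono.monotone _) (fun k => by positivity) ?_ ?_
  · exact measurableSet_le measurable_const (Finset.measurable_sum _ fun i _ => hX i)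
  · exact_mod_cast (summable_nat_add_iff 1).not.2 Real.not_summable_one_div_natCast
  · filter_upwards [eventually_exp_neg_le_measureReal_mul_sqrt_le_sum hX hind hid h0 hmean hvar
      (fun k => Finset.nonempty_Ico.2 (hmono k.lt_succ_self)) tendsto_log_add_one_atTop
      (tendsto_log_add_one_div_card_Ico hK) hκ] with k hk
    rwa [Real.exp_neg, Real.exp_log (by positivity), ← one_div] at hk

lemma ae_eventually_neg_two_mul_sqrt_le_sum_range (hX : ∀ i, Measurable (X i))
    (hind : iIndepFun X P) (hid : ∀ i, IdentDistrib (X i) Y P P)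
    (h0 : 0 ∈ interior (integrableExpSet Y P)) (hmean : P[Y] = 0) (hvar : 0 < Var[Y; P])
    {K : ℕ} (hK : 1 < K) :
    ∀ᵐ ω ∂P, ∀ᶠ k : ℕ in atTop,
      -(2 * √(2 * #(Finset.range (K ^ k)) * Var[Y; P] * Real.log (k + 1)))
        ≤ ∑ i ∈ Finset.range (K ^ k), X i ω := by
  have := hind.isProbabilityMeasure
  have hprob := eventually_measureReal_sum_le_neg_two_mul_sqrt_le hX hind hid h0 hmean hvar
    (fun k => Finset.nonempty_range_iff.2 (pow_pos (one_pos.trans hK) k).ne')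
    (tendsto_log_add_one_atTop.eventually_gt_atTop 0) (tendsto_log_add_one_div_card_range hK)
  have hsummable : Summable fun k : ℕ => Real.exp (-(2 * Real.log ((k : ℝ) + 1))) := by
    refine ((summable_nat_add_iff 1).2 (Real.summable_one_div_nat_pow.2 one_lt_two)).congr
      fun k => ?_
    rw [Real.exp_neg, two_mul, Real.exp_add, Real.exp_log (by positivity)]
    push_cast
    ring
  filter_upwards [ae_eventually_notMem_of_summable hsummable hprob] with ω hω
  filter_upwards [hω] with k hk
  exact (not_le.1 hk).le

lemma exists_lt_one_sub_one_div_mul_sqrt_sub {c : ℝ} (hc : c < 1) :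
    ∃ K : ℕ, 1 < K ∧ c < (1 - 1 / (K : ℝ)) * √(1 - 1 / K) - 2 * √(1 / K) := by
  have hinv : Tendsto (fun K : ℕ => 1 / (K : ℝ)) atTop (𝓝 0) := tendsto_one_div_atTop_nhds_zero_nat
  have hcont : Continuous fun x : ℝ => (1 - x) * √(1 - x) - 2 * √x := by fun_prop
  have h : Tendsto (fun x : ℝ => (1 - x) * √(1 - x) - 2 * √x) (𝓝 0) (𝓝 1) :=
    hcont.tendsto' 0 1 (by simp)
  exact ((eventually_gt_atTop 1).and ((h.comp hinv).eventually_const_lt hc)).exists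

lemma ae_frequently_mul_sqrt_le_sum_range_pow (hX : ∀ i, Measurable (X i)) (hind : iIndepFun X P)
    (hid : ∀ i, IdentDistrib (X i) Y P P) (h0 : 0 ∈ interior (integrableExpSet Y P))
    (hmean : P[Y] = 0) (hvar : 0 < Var[Y; P]) {c : ℝ} (hc : c < 1) :
    ∃ K : ℕ, 1 < K ∧ ∀ᵐ ω ∂P, ∃ᶠ k : ℕ in atTop,
      c * (√Var[Y; P] * √(2 * (K : ℝ) ^ (k + 1) * Real.log (k + 1)))
        ≤ ∑ i ∈ Finset.range (K ^ (k + 1)), X i ω := by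
  obtain ⟨K, hK, hcK⟩ := exists_lt_one_sub_one_div_mul_sqrt_sub hc
  refine ⟨K, hK, ?_⟩
  have hK0 : (0 : ℝ) < K := by exact_mod_cast one_pos.trans hK
  have hK1 : 1 / (K : ℝ) < 1 := (div_lt_one hK0).2 (by exact_mod_cast hK)
  filter_upwards [ae_frequently_mul_sqrt_le_sum_Ico hX hind hid h0 hmean hvar hK
      (κ := 1 - 1 / K) (sub_lt_self 1 (by positivity)),
    ae_eventually_neg_two_mul_sqrt_le_sum_range hX hind hid h0 hmean hvar hK] with ω hω_Ico hω_range
  refine (hω_Ico.and_eventually hω_range).mono fun k ⟨hIco, hrange⟩ => ?_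
  set B := √Var[Y; P] * √(2 * (K : ℝ) ^ (k + 1) * Real.log (k + 1))
  have hB (x : ℝ) (hx : 0 ≤ x) :
      √(2 * (x * (K : ℝ) ^ (k + 1)) * Var[Y; P] * Real.log (k + 1)) = √x * B := by
    simp only [B]
    rw [← Real.sqrt_mul hvar.le, ← Real.sqrt_mul hx]
    ring_nf
  have hcard : (#(Finset.range (K ^ k)) : ℝ) = 1 / K * (K : ℝ) ^ (k + 1) := by
    rw [Finset.card_range, Nat.cast_pow, pow_succ]
    field_simp
  rw [natCast_card_Ico_pow (one_pos.trans hK), hB _ (sub_pos.2 hK1).le] at hIco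
  rw [hcard, hB _ (by positivity)] at hrange
  rw [← Finset.sum_range_add_sum_Ico _ (Nat.pow_le_pow_right (one_pos.trans hK) (k.le_add_right 1))]
  have hcB : c * B ≤ ((1 - 1 / (K : ℝ)) * √(1 - 1 / K) - 2 * √(1 / K)) * B := by gcongr
  linarith

-- Along the blocks `[K ^ k, K ^ (k + 1))` the sums are independent, and for large `K` the block
-- carries nearly all of the sum up to `K ^ (k + 1)`.
theorem ae_frequently_mul_lilScale_le_sum (hX : ∀ i, Measurable (X i)) (hind : iIndepFun X P)
    (hid : ∀ i, IdentDistrib (X i) Y P P) (h0 : 0 ∈ interior (integrableExpSet Y P))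
    (hmean : P[Y] = 0) (hvar : 0 < Var[Y; P]) {a : ℝ} (ha : a < √Var[Y; P]) :
    ∀ᵐ ω ∂P, ∃ᶠ n in atTop, a * lilScale n ≤ ∑ i ∈ Finset.range n, X i ω := by
  have hsqrt : 0 < √Var[Y; P] := Real.sqrt_pos.2 hvar
  obtain ⟨c, hac, hc⟩ := exists_between ((div_lt_one hsqrt).2 ha)
  obtain ⟨K, hK, hfreq⟩ := ae_frequently_mul_sqrt_le_sum_range_pow hX hind hid h0 hmean hvar hc
  have hK0 : (0 : ℝ) < K := by exact_mod_cast one_pos.trans hK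
  have hscale := ((tendsto_lilScale_pow_div hK).const_mul a).eventually_lt_const
    (show a * 1 < c * √Var[Y; P] by rw [mul_one]; exact (div_lt_iff₀ hsqrt).1 hac)
  have htendsto : Tendsto (fun k => K ^ (k + 1)) atTop atTop :=
    (tendsto_pow_atTop_atTop_of_one_lt hK).comp (tendsto_add_atTop_nat 1)
  filter_upwards [hfreq] with ω hω
  refine htendsto.frequently ((hω.and_eventually (hscale.and
    (tendsto_log_add_one_atTop.eventually_gt_atTop 0))).mono fun k ⟨hk, hlt, hlog⟩ => ?_)
  have hD : 0 < √(2 * (K : ℝ) ^ (k + 1) * Real.log (k + 1)) := Real.sqrt_pos.2 (by positivity)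
  rw [← mul_div_assoc, div_lt_iff₀ hD, mul_assoc] at hlt
  exact hlt.le.trans hk

end IIDLowerBound

section UpperBound

variable {Ω : Type*} [mΩ : MeasurableSpace Ω] {P : Measure Ω}

lemma mul_measureReal_exists_le_le_integral [IsFiniteMeasure P] {𝒢 : Filtration ℕ mΩ}
    {f : ℕ → Ω → ℝ} (hf : Submartingale f 𝒢 P) (hf0 : 0 ≤ f) {x : ℝ} (hx : 0 ≤ x) (n : ℕ) :
    x * P.real {ω | ∃ t ≤ n, x ≤ f t ω} ≤ ∫ ω, f n ω ∂P := by
  have hset : {ω | ∃ t ≤ n, x ≤ f t ω} = {ω | x ≤ (Finset.range (n + 1)).sup'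
      Finset.nonempty_range_add_one fun t => f t ω} := by
    ext ω
    simp [Finset.le_sup'_iff]
  rw [hset]
  have h := ENNReal.toReal_mono ENNReal.ofReal_ne_top (maximal_ineq hf hf0 (ε := ⟨x, hx⟩) n)
  rw [ENNReal.toReal_mul, ENNReal.toReal_ofReal (integral_nonneg (hf0 n))] at h
  exact h.trans (setIntegral_le_integral (hf.integrable n) (Eventually.of_forall (hf0 n)))

lemma exists_one_lt_pow_three_mul_le {c d : ℝ} (hcd : c < d) : ∃ θ : ℝ, 1 < θ ∧ θ ^ 3 * c ≤ d := by
  have hcont : Continuous fun θ : ℝ => θ ^ 3 * c := by fun_prop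
  have h : Tendsto (fun θ : ℝ => θ ^ 3 * c) (𝓝[>] 1) (𝓝 c) :=
    (hcont.tendsto' 1 c (by ring)).mono_left nhdsWithin_le_nhds
  obtain ⟨θ, hθ, hlt⟩ := (eventually_mem_nhdsWithin.and (h.eventually_lt_const hcd)).exists
  exact ⟨θ, hθ, hlt.le⟩

lemma le_mul_lilScale_of_mul_sub_le {t : ℕ} {X N a w b θ T ℓ : ℝ} (ha : 0 < a) (hw : 0 < w)
    (hb : 0 ≤ b) (hθ : 0 < θ) (hT : 0 < T) (hℓ : 0 < ℓ) (hNT : N ≤ a * T) (hTt : T ≤ θ * t)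
    (hℓt : ℓ ≤ θ * Real.log (Real.log t)) (hθb : θ ^ 3 * (a * w) ≤ b ^ 2)
    (h : √(2 * θ * ℓ / (w * a * T)) * X - √(2 * θ * ℓ / (w * a * T)) ^ 2 * w / 2 * N ≤ θ * ℓ) :
    X ≤ b * lilScale t := by
  set s := √(2 * θ * ℓ / (w * a * T))
  have hs : 0 < s := Real.sqrt_pos.2 (by positivity)
  have hs_sq : s ^ 2 * (w * a * T) = 2 * θ * ℓ := by
    rw [Real.sq_sqrt (by positivity)]
    field_simp
  have hN : s ^ 2 * w / 2 * N ≤ s ^ 2 * w / 2 * (a * T) := by gcongr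
  have hX : X ≤ s * (w * a * T) := le_of_mul_le_mul_left (by linarith) hs
  have hLL : 0 < Real.log (Real.log t) := pos_of_mul_pos_right (hℓ.trans_le hℓt) hθ.le
  have ht : (0 : ℝ) < t := pos_of_mul_pos_right (hT.trans_le hTt) hθ.le
  rw [lilScale, ← Real.sqrt_sq hb, ← Real.sqrt_mul (sq_nonneg b)]
  refine hX.trans (Real.le_sqrt_of_sq_le ?_)
  calc (s * (w * a * T)) ^ 2
      = s ^ 2 * (w * a * T) * (w * a * T) := by ring
    _ = 2 * θ * ℓ * (w * a * T) := by rw [hs_sq]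
    _ ≤ 2 * θ * (θ * Real.log (Real.log t)) * (w * a * (θ * t)) := by gcongr
    _ = θ ^ 3 * (a * w) * (2 * t * Real.log (Real.log t)) := by ring
    _ ≤ b ^ 2 * (2 * t * Real.log (Real.log t)) := by gcongr

lemma tendsto_sqrt_log_div_pow {θ c d : ℝ} (hθ : 1 < θ) (hc : 0 < c) (hd : 0 < d) :
    Tendsto (fun k : ℕ => √(c * Real.log (k + 1) / (d * θ ^ (k + 1)))) atTop (𝓝[>] 0) := by
  have hθ0 : 0 < θ := one_pos.trans hθ
  refine tendsto_nhdsWithin_iff.2 ⟨?_, ?_⟩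
  · have h := ((tendsto_log_add_one_div_pow hθ).const_mul (c / (d * θ))).sqrt
    rw [mul_zero, Real.sqrt_zero] at h
    refine h.congr fun k => ?_
    rw [div_mul_div_comm, pow_succ', mul_assoc d]
  · filter_upwards [tendsto_log_add_one_atTop.eventually_gt_atTop 0] with k hk
    exact Real.sqrt_pos.2 (by positivity)

-- On the block `θ ^ k ≤ t < θ ^ (k + 1)` a bound `s X - s² w N / 2 ≤ θ log (k + 1)`, with the `s`
-- that is optimal for `N = a θ ^ (k + 1)`, implies `X ≤ b φ(t)`.
theorem ae_eventually_le_mul_lilScale [IsFiniteMeasure P] {X N : ℕ → Ω → ℝ} {a b w : ℝ}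
    (ha : 0 < a) (hw : 0 < w)
    (htail : ∀ᶠ s in 𝓝[>] 0, ∀ (n : ℕ) (x : ℝ),
      P.real {ω | ∃ t ≤ n, x ≤ s * X t ω - s ^ 2 * w / 2 * N t ω} ≤ Real.exp (-x))
    (hab : √(a * w) < b) :
    ∀ᵐ ω ∂P, (∀ᶠ t : ℕ in atTop, N t ω ≤ a * t) → ∀ᶠ t in atTop, X t ω ≤ b * lilScale t := by
  have hb : 0 ≤ b := (Real.sqrt_nonneg _).trans hab.le
  obtain ⟨θ, hθ, hθb⟩ := exists_one_lt_pow_three_mul_le (Real.lt_sq_of_sqrt_lt hab)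
  have hθ0 : 0 < θ := one_pos.trans hθ
  set s : ℕ → ℝ := fun k => √(2 * θ * Real.log (k + 1) / (w * a * θ ^ (k + 1)))
  have hs : Tendsto s atTop (𝓝[>] 0) :=
    tendsto_sqrt_log_div_pow hθ (by positivity) (by positivity)
  have hsummable : Summable fun k : ℕ => Real.exp (-(θ * Real.log ((k : ℝ) + 1))) := by
    refine ((summable_nat_add_iff 1).2 (Real.summable_nat_rpow.2 (neg_lt_neg hθ))).congr fun k => ?_
    rw [Real.rpow_def_of_pos (by positivity)]
    push_cast
    ring_nf
  have hblock := ae_eventually_notMem_of_summable (P := P) (E := fun k => {ω | ∃ t ≤ ⌊θ ^ (k + 1)⌋₊,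
      θ * Real.log (k + 1) ≤ s k * X t ω - s k ^ 2 * w / 2 * N t ω}) hsummable
    ((hs.eventually htail).mono fun k hk => hk _ _)
  filter_upwards [hblock] with ω hω hN
  obtain ⟨k₀, hk₀⟩ := eventually_atTop.1 (hω.and ((eventually_log_add_one_le_mul_log_log hθ).and
    (tendsto_log_add_one_atTop.eventually_gt_atTop 0)))
  filter_upwards [hN, eventually_ge_atTop 1,
    tendsto_natCast_atTop_atTop.eventually_ge_atTop (θ ^ k₀)] with t hNt ht1 ht
  obtain ⟨k, hkt, htk⟩ := exists_nat_pow_near (by exact_mod_cast ht1 : (1 : ℝ) ≤ t) hθ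
  have hkk₀ : k₀ ≤ k := Nat.lt_succ_iff.1 ((pow_lt_pow_iff_right₀ hθ).1 (ht.trans_lt htk))
  obtain ⟨hnot, hloglog, hlog⟩ := hk₀ k hkk₀
  refine le_mul_lilScale_of_mul_sub_le ha hw hb hθ0 (pow_pos hθ0 (k + 1)) hlog
    (hNt.trans (by gcongr)) ?_ (hloglog t hkt) hθb ?_
  · rw [pow_succ']
    gcongr
  · exact (not_le.1 fun hle => hnot ⟨t, Nat.le_floor htk.le, hle⟩).le

end UpperBound

section AttemptNoise

variable {Ω : Type*} {p : ℝ} {A B : Set Ω}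

/-- The increment of `M_j` in a slot in which client `j` is attempted, `A` being the event that the
channel is good and `p` its probability. -/
noncomputable def attemptNoise (p : ℝ) (A : Set Ω) (ω : Ω) : ℝ := 1 - 1 / p * A.indicator 1 ω

lemma comp_attemptNoise (f : ℝ → ℝ) (ω : Ω) :
    f (attemptNoise p A ω) = f 1 + A.indicator (fun _ => f (1 - 1 / p) - f 1) ω := by
  by_cases h : ω ∈ A <;> simp [attemptNoise, h]

lemma attemptNoise_congr {ω : Ω} (h : ω ∈ A ↔ ω ∈ B) :
    attemptNoise p A ω = attemptNoise p B ω := by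
  by_cases hA : ω ∈ A
  · simp [attemptNoise, hA, h.1 hA]
  · simp [attemptNoise, hA, mt h.2 hA]

lemma attemptNoise_preimage (s : Set ℝ) :
    attemptNoise p A ⁻¹' s = {ω | 1 - 1 / p ∈ s ∧ ω ∈ A ∨ 1 ∈ s ∧ ω ∉ A} := by
  ext ω
  by_cases h : ω ∈ A <;> simp [attemptNoise, h]

variable [mΩ : MeasurableSpace Ω] {P : Measure Ω}

lemma measurable_comp_attemptNoise (hA : MeasurableSet A) (f : ℝ → ℝ) :
    Measurable fun ω => f (attemptNoise p A ω) := by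
  simp only [comp_attemptNoise f]
  exact measurable_const.add (measurable_const.indicator hA)

lemma integrable_mul_comp_attemptNoise (hA : MeasurableSet A) {b : Ω → ℝ} (hb : Integrable b P)
    (f : ℝ → ℝ) : Integrable (fun ω => b ω * f (attemptNoise p A ω)) P := by
  refine hb.mul_bdd (c := max |f (1 - 1 / p)| |f 1|)
    (measurable_comp_attemptNoise hA f).aestronglyMeasurable (Eventually.of_forall fun ω => ?_)
  by_cases h : ω ∈ A <;> simp [comp_attemptNoise f, h]

lemma integrable_comp_attemptNoise [IsFiniteMeasure P] (hA : MeasurableSet A) (f : ℝ → ℝ) :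
    Integrable (fun ω => f (attemptNoise p A ω)) P := by
  simpa using integrable_mul_comp_attemptNoise hA (integrable_const (1 : ℝ)) f

lemma integrableExpSet_attemptNoise [IsFiniteMeasure P] (hA : MeasurableSet A) :
    integrableExpSet (attemptNoise p A) P = Set.univ :=
  Set.eq_univ_of_forall fun s => integrable_comp_attemptNoise hA fun x => Real.exp (s * x)

lemma measurable_attemptNoise (hA : MeasurableSet A) : Measurable (attemptNoise p A) :=
  measurable_comp_attemptNoise hA fun x => x

lemma identDistrib_attemptNoise [IsFiniteMeasure P] (hA : MeasurableSet A) (hB : MeasurableSet B)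
    (hAB : P A = P B) : IdentDistrib (attemptNoise p A) (attemptNoise p B) P P := by
  have hcompl : P Aᶜ = P Bᶜ := by
    rw [measure_compl hA (measure_ne_top P A), measure_compl hB (measure_ne_top P B), hAB]
  refine ⟨(measurable_attemptNoise hA).aemeasurable, (measurable_attemptNoise hB).aemeasurable,
    Measure.ext fun s hs => ?_⟩
  rw [Measure.map_apply (measurable_attemptNoise hA) hs,
    Measure.map_apply (measurable_attemptNoise hB) hs, attemptNoise_preimage, attemptNoise_preimage]
  by_cases h : 1 - 1 / p ∈ s <;> by_cases h' : (1 : ℝ) ∈ s <;>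
    simp only [h, h', true_and, false_and, or_false, false_or, em]
  exacts [hAB, hcompl]

lemma iIndepFun_attemptNoise {ι : Type*} {A : ι → Set Ω} (hind : iIndepSet A P) :
    iIndepFun (fun k => attemptNoise p (A k)) P :=
  (hind.iIndepFun_indicator (β := ℝ)).comp (fun _ x => 1 - 1 / p * x) fun _ => by fun_prop

variable [IsProbabilityMeasure P]

lemma integral_comp_attemptNoise (hA : MeasurableSet A) (hPA : P.real A = p) (f : ℝ → ℝ) :
    ∫ ω, f (attemptNoise p A ω) ∂P = (1 - p) * f 1 + p * f (1 - 1 / p) := by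
  simp only [comp_attemptNoise f]
  rw [integral_add (integrable_const _) ((integrable_const _).indicator hA),
    integral_indicator_const _ hA, integral_const, probReal_univ, hPA]
  simp only [smul_eq_mul]
  ring

lemma integral_attemptNoise (hp : p ≠ 0) (hA : MeasurableSet A) (hPA : P.real A = p) :
    ∫ ω, attemptNoise p A ω ∂P = 0 := by
  rw [integral_comp_attemptNoise hA hPA fun x => x]
  field_simp
  ring

lemma integral_attemptNoise_sq (hp : p ≠ 0) (hA : MeasurableSet A) (hPA : P.real A = p) :
    ∫ ω, attemptNoise p A ω ^ 2 ∂P = (1 - p) / p := by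
  rw [integral_comp_attemptNoise hA hPA fun x => x ^ 2]
  field_simp
  ring

lemma variance_attemptNoise (hp : p ≠ 0) (hA : MeasurableSet A) (hPA : P.real A = p) :
    Var[attemptNoise p A; P] = (1 - p) / p := by
  rw [variance_of_integral_eq_zero (measurable_attemptNoise hA).aemeasurable
    (integral_attemptNoise hp hA hPA), integral_attemptNoise_sq hp hA hPA]

end AttemptNoise

namespace ScheduledSystem

variable {Ω : Type*} [mΩ : MeasurableSpace Ω] {P : Measure Ω} {p : Fin 2 → ℝ}

/-- The number of attempts of client `j` in the slots `1, …, t`. -/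
def attempts (S : ScheduledSystem P p) (j : Fin 2) (t : ℕ) (ω : Ω) : ℕ :=
  ∑ l ∈ Finset.range t, if S.serve (l + 1) ω = some j then 1 else 0

/-- The exponential martingale `exp (r M_j(t) - Λ(r) N_j(t))`, where `N_j(t)` is the number of
attempts up to slot `t` and `Λ` the cumulant generating function of the increment of `M_j` in an
attempt, which is the same for all slots and is read off slot `1`. -/
noncomputable def expMartingale (S : ScheduledSystem P p) (j : Fin 2) (r : ℝ) (t : ℕ) (ω : Ω) : ℝ :=
  Real.exp (r * S.M j t ω - cgf (attemptNoise (p j) (S.good 1 j)) P r * S.attempts j t ω)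

variable (S : ScheduledSystem P p) (j : Fin 2)

lemma attempts_zero (ω : Ω) : S.attempts j 0 ω = 0 := Finset.sum_range_zero _

lemma attempts_succ (t : ℕ) (ω : Ω) : S.attempts j (t + 1) ω
    = S.attempts j t ω + if S.serve (t + 1) ω = some j then 1 else 0 :=
  Finset.sum_range_succ _ _

lemma attempts_mono (ω : Ω) : Monotone fun t => S.attempts j t ω :=
  monotone_nat_of_le_succ fun t => by rw [attempts_succ]; exact Nat.le_add_right _ _

lemma attempts_le (t : ℕ) (ω : Ω) : S.attempts j t ω ≤ t := by
  induction t with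
  | zero => rw [attempts_zero]
  | succ t ih => rw [attempts_succ]; split_ifs <;> omega

lemma attempts_add_attempts_le (t : ℕ) (ω : Ω) : S.attempts 0 t ω + S.attempts 1 t ω ≤ t := by
  induction t with
  | zero => simp [attempts_zero]
  | succ t ih =>
    rw [attempts_succ, attempts_succ]
    split_ifs with h0 h1
    · simp [h0] at h1
    all_goals omega

lemma u_eq_ite (t : ℕ) (ω : Ω) : S.u j t ω = if S.serve t ω = some j then 1 else 0 := by
  simp [u, Set.indicator_apply]

lemma u_sq (t : ℕ) (ω : Ω) : S.u j t ω ^ 2 = S.u j t ω := by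
  rw [u_eq_ite]; split_ifs <;> simp

lemma natCast_attempts_succ (t : ℕ) (ω : Ω) :
    (S.attempts j (t + 1) ω : ℝ) = S.attempts j t ω + S.u j (t + 1) ω := by
  rw [attempts_succ, u_eq_ite]; split_ifs <;> simp

lemma sum_u_eq_attempts (t : ℕ) (ω : Ω) :
    ∑ l ∈ Finset.Icc 1 t, S.u j l ω = S.attempts j t ω := by
  induction t with
  | zero => simp [attempts_zero]
  | succ t ih => rw [Finset.sum_Icc_succ_top (by omega), ih, natCast_attempts_succ]

lemma M_zero : S.M j 0 = 0 := by
  ext ω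
  simp [M]

lemma m_eq_u_mul_attemptNoise (t : ℕ) (ω : Ω) :
    S.m j t ω = S.u j t ω * attemptNoise (p j) (S.good t j) ω := by
  by_cases h : S.serve t ω = some j <;> by_cases h' : ω ∈ S.good t j <;>
    simp [m, g, u, attemptNoise, h, h']

lemma M_succ (t : ℕ) (ω : Ω) : S.M j (t + 1) ω
    = S.M j t ω + S.u j (t + 1) ω * attemptNoise (p j) (S.good (t + 1) j) ω := by
  rw [← m_eq_u_mul_attemptNoise]
  exact Finset.sum_Icc_succ_top (by omega) _

lemma M_eq_attempts_sub (t : ℕ) (ω : Ω) :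
    S.M j t ω = S.attempts j t ω - (1 / p j) * ∑ l ∈ Finset.Icc 1 t, S.g j l ω := by
  rw [← sum_u_eq_attempts, Finset.mul_sum, ← Finset.sum_sub_distrib]
  rfl

lemma expMartingale_zero (r : ℝ) : S.expMartingale j r 0 = 1 := by
  ext ω
  simp [expMartingale, M_zero, attempts_zero]

lemma expMartingale_succ (r : ℝ) (t : ℕ) (ω : Ω) :
    S.expMartingale j r (t + 1) ω
      = (S.expMartingale j r t ω - S.expMartingale j r t ω * S.u j (t + 1) ω)
        + S.expMartingale j r t ω * S.u j (t + 1) ω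
          * Real.exp (r * attemptNoise (p j) (S.good (t + 1) j) ω
            - cgf (attemptNoise (p j) (S.good 1 j)) P r) := by
  rw [expMartingale, M_succ, natCast_attempts_succ, u_eq_ite]
  split_ifs
  · rw [expMartingale, mul_one, sub_self, zero_add, ← Real.exp_add]
    ring_nf
  · simp [expMartingale]

section Measurability

lemma stronglyMeasurable_u (t : ℕ) : StronglyMeasurable[S.ℱ t] (S.u j (t + 1)) :=
  stronglyMeasurable_one.indicator (S.serve_predictable t j)

lemma stronglyMeasurable_m (t : ℕ) : StronglyMeasurable[S.ℱ (t + 1)] (S.m j (t + 1)) :=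
  ((S.stronglyMeasurable_u j t).mono (S.ℱ.mono t.le_succ)).sub
    ((stronglyMeasurable_one.indicator (S.delivery_observed t j)).const_mul _)

lemma stronglyAdapted_M : StronglyAdapted S.ℱ (S.M j) := fun t =>
  Finset.stronglyMeasurable_fun_sum _ fun l hl => by
    obtain ⟨i, rfl⟩ := Nat.exists_eq_succ_of_ne_zero
      (Nat.one_le_iff_ne_zero.1 (Finset.mem_Icc.1 hl).1)
    exact (S.stronglyMeasurable_m j i).mono (S.ℱ.mono (Finset.mem_Icc.1 hl).2)

lemma measurable_attempts (t : ℕ) : Measurable[S.ℱ t] (S.attempts j t) :=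
  Finset.measurable_sum _ fun l hl => Measurable.ite
    (S.ℱ.mono (Finset.mem_range.1 hl).le _ (S.serve_predictable l j))
    measurable_const measurable_const

lemma stronglyAdapted_expMartingale (r : ℝ) : StronglyAdapted S.ℱ (S.expMartingale j r) := fun t =>
  (((S.stronglyAdapted_M j t).measurable.const_mul r).sub
    ((measurable_from_top.comp (S.measurable_attempts j t)).const_mul _)).exp.stronglyMeasurable

end Measurability

section ConditionalExpectation

lemma integrable_mul_u {b : Ω → ℝ} (hb : Integrable b P) (t : ℕ) :
    Integrable (fun ω => b ω * S.u j (t + 1) ω) P := by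
  refine hb.mul_bdd (c := 1)
    ((S.stronglyMeasurable_u j t).mono (S.ℱ.le t)).aestronglyMeasurable
    (Eventually.of_forall fun ω => ?_)
  rw [u_eq_ite]
  split_ifs <;> simp

lemma measureReal_good (hp : 0 ≤ p j) (t : ℕ) : P.real (S.good (t + 1) j) = p j := by
  rw [measureReal_def, S.good_prob, ENNReal.toReal_ofReal hp]

variable [IsProbabilityMeasure P]

lemma integrable_u (t : ℕ) : Integrable (S.u j (t + 1)) P := by
  simpa using S.integrable_mul_u j (integrable_const (1 : ℝ)) t

lemma indep_generateFrom_good (t : ℕ) :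
    Indep (MeasurableSpace.generateFrom {S.good (t + 1) j}) (S.ℱ t) P := by
  refine IndepSets.indep (MeasurableSpace.generateFrom_le fun A hA => ?_) (S.ℱ.le t)
    (IsPiSystem.singleton _) (@MeasurableSpace.isPiSystem_measurableSet Ω (S.ℱ t)) rfl
    (@MeasurableSpace.generateFrom_measurableSet Ω (S.ℱ t)).symm ?_
  · rw [Set.mem_singleton_iff.1 hA]
    exact S.good_measurable t j
  · rw [IndepSets_iff]
    intro A B hA hB
    rw [Set.mem_singleton_iff.1 hA]
    exact (S.good_indep t j B hB).measure_inter_eq_mul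

lemma condExp_comp_attemptNoise (f : ℝ → ℝ) (t : ℕ) :
    P[fun ω => f (attemptNoise (p j) (S.good (t + 1) j) ω) | S.ℱ t]
      =ᵐ[P] fun _ => ∫ ω, f (attemptNoise (p j) (S.good (t + 1) j) ω) ∂P := by
  refine condExp_indep_eq (MeasurableSpace.generateFrom_le fun A hA => ?_) (S.ℱ.le t)
    (Measurable.stronglyMeasurable ?_) (S.indep_generateFrom_good j t)
  · rw [Set.mem_singleton_iff.1 hA]
    exact S.good_measurable t j
  · exact measurable_comp_attemptNoise (mΩ := MeasurableSpace.generateFrom _)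
      (MeasurableSpace.measurableSet_generateFrom (Set.mem_singleton _)) f

lemma condExp_mul_comp_attemptNoise (f : ℝ → ℝ) {t : ℕ} {b : Ω → ℝ}
    (hb : StronglyMeasurable[S.ℱ t] b) (hb_int : Integrable b P) :
    P[fun ω => b ω * f (attemptNoise (p j) (S.good (t + 1) j) ω) | S.ℱ t]
      =ᵐ[P] fun ω => b ω * ∫ ω', f (attemptNoise (p j) (S.good (t + 1) j) ω') ∂P := by
  filter_upwards [condExp_mul_of_stronglyMeasurable_left hb
    (integrable_mul_comp_attemptNoise (S.good_measurable t j) hb_int f)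
    (integrable_comp_attemptNoise (S.good_measurable t j) f),
    S.condExp_comp_attemptNoise j f t] with ω hmul hcomp
  exact hmul.trans (congrArg (b ω * ·) hcomp)

lemma condExp_add_mul_comp_attemptNoise (f : ℝ → ℝ) {t : ℕ} {a b : Ω → ℝ}
    (ha : StronglyMeasurable[S.ℱ t] a) (ha_int : Integrable a P)
    (hb : StronglyMeasurable[S.ℱ t] b) (hb_int : Integrable b P) :
    P[fun ω => a ω + b ω * f (attemptNoise (p j) (S.good (t + 1) j) ω) | S.ℱ t]
      =ᵐ[P] fun ω => a ω + b ω * ∫ ω', f (attemptNoise (p j) (S.good (t + 1) j) ω') ∂P := by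
  filter_upwards [condExp_add ha_int
    (integrable_mul_comp_attemptNoise (S.good_measurable t j) hb_int f) (S.ℱ t),
    S.condExp_mul_comp_attemptNoise j f hb hb_int] with ω hadd hmul
  refine hadd.trans ?_
  rw [Pi.add_apply, condExp_of_stronglyMeasurable (S.ℱ.le t) ha ha_int, hmul]

lemma condExp_sq_m (hp : 0 < p j) {t : ℕ} (ht : 1 ≤ t) :
    P[fun ω => S.m j t ω ^ 2 | S.ℱ (t - 1)] =ᵐ[P] fun ω => S.u j t ω * ((1 - p j) / p j) := by
  obtain ⟨t, rfl⟩ := Nat.exists_eq_add_of_le' ht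
  simp only [m_eq_u_mul_attemptNoise, mul_pow, u_sq, Nat.add_sub_cancel]
  rw [← integral_attemptNoise_sq hp.ne' (S.good_measurable t j) (S.measureReal_good j hp.le t)]
  exact S.condExp_mul_comp_attemptNoise j (fun x => x ^ 2) (S.stronglyMeasurable_u j t)
    (S.integrable_u j t)

lemma integrable_M (t : ℕ) : Integrable (S.M j t) P := by
  induction t with
  | zero => rw [M_zero]; exact integrable_zero _ _ _
  | succ t ih =>
    rw [show S.M j (t + 1) = _ from funext fun ω => S.M_succ j t ω]
    exact ih.add (integrable_mul_comp_attemptNoise (S.good_measurable t j) (S.integrable_u j t) id)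

theorem martingale_M (hp : 0 < p j) : Martingale (S.M j) S.ℱ P := by
  refine martingale_nat (S.stronglyAdapted_M j) (S.integrable_M j) fun t => ?_
  have h := S.condExp_add_mul_comp_attemptNoise j (fun x => x) (S.stronglyAdapted_M j t)
    (S.integrable_M j t) (S.stronglyMeasurable_u j t) (S.integrable_u j t)
  simp only [integral_attemptNoise hp.ne' (S.good_measurable t j) (S.measureReal_good j hp.le t),
    mul_zero, add_zero, ← M_succ] at h
  exact h.symm

lemma integral_exp_attemptNoise_sub_cgf (r : ℝ) (t : ℕ) :
    ∫ ω, Real.exp (r * attemptNoise (p j) (S.good (t + 1) j) ω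
      - cgf (attemptNoise (p j) (S.good 1 j)) P r) ∂P = 1 := by
  have hid := identDistrib_attemptNoise (p := p j) (S.good_measurable t j) (S.good_measurable 0 j)
    ((S.good_prob t j).trans (S.good_prob 0 j).symm)
  have hexp : Integrable (fun ω => Real.exp (r * attemptNoise (p j) (S.good 1 j) ω)) P :=
    integrable_comp_attemptNoise (S.good_measurable 0 j) fun x => Real.exp (r * x)
  simp only [Real.exp_sub, integral_div, exp_cgf hexp]
  exact (div_eq_one_iff_eq (mgf_pos hexp).ne').2 (congrFun (mgf_congr_identDistrib hid) r)

lemma integrable_expMartingale (r : ℝ) (t : ℕ) : Integrable (S.expMartingale j r t) P := by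
  induction t with
  | zero => rw [expMartingale_zero]; exact integrable_const _
  | succ t ih =>
    rw [show S.expMartingale j r (t + 1) = _ from funext fun ω => S.expMartingale_succ j r t ω]
    exact (ih.sub (S.integrable_mul_u j ih t)).add (integrable_mul_comp_attemptNoise
      (S.good_measurable t j) (S.integrable_mul_u j ih t) fun x => Real.exp (r * x - _))

theorem martingale_expMartingale (r : ℝ) : Martingale (S.expMartingale j r) S.ℱ P := by
  refine martingale_nat (S.stronglyAdapted_expMartingale j r) (S.integrable_expMartingale j r)
    fun t => ?_
  have hmeas := S.stronglyAdapted_expMartingale j r t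
  have hint := S.integrable_expMartingale j r t
  have hu := S.stronglyMeasurable_u j t
  have h := S.condExp_add_mul_comp_attemptNoise j
    (fun x => Real.exp (r * x - cgf (attemptNoise (p j) (S.good 1 j)) P r))
    (hmeas.fun_sub (hmeas.fun_mul hu)) (hint.sub (S.integrable_mul_u j hint t)) (hmeas.fun_mul hu)
    (S.integrable_mul_u j hint t)
  simp only [integral_exp_attemptNoise_sub_cgf, mul_one, sub_add_cancel,
    ← expMartingale_succ] at h
  exact h.symm

lemma integral_expMartingale (r : ℝ) (t : ℕ) : ∫ ω, S.expMartingale j r t ω ∂P = 1 := by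
  have h := (S.martingale_expMartingale j r).setIntegral_eq t.zero_le MeasurableSet.univ
  rw [setIntegral_univ, setIntegral_univ, expMartingale_zero] at h
  simpa using h.symm

lemma measureReal_exists_le_mul_M_sub_cgf_mul_attempts_le (r : ℝ) (n : ℕ) (x : ℝ) :
    P.real {ω | ∃ t ≤ n, x ≤ r * S.M j t ω
      - cgf (attemptNoise (p j) (S.good 1 j)) P r * S.attempts j t ω} ≤ Real.exp (-x) := by
  have h := mul_measureReal_exists_le_le_integral (S.martingale_expMartingale j r).submartingale
    (fun t ω => (Real.exp_pos _).le) (Real.exp_pos x).le n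
  rw [integral_expMartingale] at h
  simp only [expMartingale, Real.exp_le_exp] at h
  rwa [Real.exp_neg, ← one_div, le_div_iff₀' (Real.exp_pos x)]

end ConditionalExpectation

section AttemptRates

variable [IsProbabilityMeasure P] {q : Fin 2 → ℝ}

lemma eventually_cgf_attemptNoise_le (hp : 0 < p j) {w : ℝ} (hw : (1 - p j) / p j < w) (t : ℕ) :
    ∀ᶠ r in 𝓝 0, cgf (attemptNoise (p j) (S.good (t + 1) j)) P r ≤ r ^ 2 * w / 2 := by
  have hA := S.good_measurable t j
  have hPA := S.measureReal_good j hp.le t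
  have h0 : (0 : ℝ) ∈ interior (integrableExpSet (attemptNoise (p j) (S.good (t + 1) j)) P) := by
    simp [integrableExpSet_attemptNoise hA]
  filter_upwards [eventually_mgf_le_exp h0 (integral_attemptNoise hp.ne' hA hPA)
    ((variance_attemptNoise hp.ne' hA hPA).trans_lt hw)] with r hr
  refine (Real.log_le_iff_le_exp (mgf_pos ?_)).2 hr
  exact integrable_comp_attemptNoise hA fun x => Real.exp (r * x)

lemma eventually_measureReal_exists_le_le (hp : 0 < p j) {w : ℝ} (hw : (1 - p j) / p j < w)
    {σ : ℝ} (hσ : σ ^ 2 = 1) :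
    ∀ᶠ s in 𝓝[>] 0, ∀ (n : ℕ) (x : ℝ), P.real {ω | ∃ t ≤ n,
      x ≤ s * (σ * S.M j t ω) - s ^ 2 * w / 2 * S.attempts j t ω} ≤ Real.exp (-x) := by
  have hlim : Tendsto (fun s : ℝ => s * σ) (𝓝[>] 0) (𝓝 0) :=
    ((continuous_mul_const σ).tendsto' 0 0 (zero_mul σ)).mono_left nhdsWithin_le_nhds
  filter_upwards [hlim.eventually (S.eventually_cgf_attemptNoise_le j hp hw 0)] with s hs n x
  rw [mul_pow, hσ, mul_one] at hs
  refine (measureReal_mono ?_).trans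
    (S.measureReal_exists_le_mul_M_sub_cgf_mul_attempts_le j (s * σ) n x)
  rintro ω ⟨t, ht, hx⟩
  refine ⟨t, ht, hx.trans ?_⟩
  rw [mul_assoc]
  gcongr

theorem ae_eventually_abs_M_le (hp : 0 < p j) {a b : ℝ} (ha : 0 < a)
    (hab : √(a * ((1 - p j) / p j)) < b) :
    ∀ᵐ ω ∂P, (∀ᶠ t : ℕ in atTop, S.attempts j t ω ≤ a * t) →
      ∀ᶠ t in atTop, |S.M j t ω| ≤ b * lilScale t := by
  have hb : 0 < b := (Real.sqrt_nonneg _).trans_lt hab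
  obtain ⟨w, hw, hwb⟩ := exists_between (max_lt
    ((lt_div_iff₀' ha).2 ((Real.sqrt_lt' hb).1 hab)) (by positivity : 0 < b ^ 2 / a))
  obtain ⟨hvw, hw0⟩ := max_lt_iff.1 hw
  have hbound : ∀ σ : ℝ, σ ^ 2 = 1 → ∀ᵐ ω ∂P, (∀ᶠ t : ℕ in atTop, S.attempts j t ω ≤ a * t) →
      ∀ᶠ t in atTop, σ * S.M j t ω ≤ b * lilScale t := fun σ hσ =>
    ae_eventually_le_mul_lilScale ha hw0 (S.eventually_measureReal_exists_le_le j hp hvw hσ)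
      ((Real.sqrt_lt' hb).2 ((lt_div_iff₀' ha).1 hwb))
  filter_upwards [hbound 1 (by norm_num), hbound (-1) (by norm_num)] with ω hupper hlower hN
  filter_upwards [hupper hN, hlower hN] with t ht ht'
  exact abs_le'.2 ⟨by linarith, by linarith⟩

theorem ae_tendsto_M_div (hp : 0 < p j) :
    ∀ᵐ ω ∂P, Tendsto (fun t : ℕ => S.M j t ω / t) atTop (𝓝 0) := by
  filter_upwards [S.ae_eventually_abs_M_le j hp one_pos (lt_add_one _)] with ω hω
  have hlim := tendsto_lilScale_div.const_mul (√(1 * ((1 - p j) / p j)) + 1)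
  rw [mul_zero] at hlim
  refine squeeze_zero_norm' ?_ hlim
  filter_upwards [hω (Eventually.of_forall fun t => by
    rw [one_mul]; exact_mod_cast S.attempts_le j t ω)] with t ht
  rw [norm_div, Real.norm_natCast, Real.norm_eq_abs, ← mul_div_assoc]
  gcongr

lemma ae_eventually_lt_attempts_div (hp : 0 < p j) (hful : S.Fulfils q) :
    ∀ᵐ ω ∂P, ∀ x < q j / p j, ∀ᶠ t : ℕ in atTop, x < (S.attempts j t ω : ℝ) / t := by
  filter_upwards [S.ae_tendsto_M_div j hp, hful j] with ω hM hg x hx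
  obtain ⟨y, hxy, hy⟩ := exists_between hx
  have hbdd : IsBoundedUnder (· ≥ ·) atTop
      fun T : ℕ => (∑ t ∈ Finset.Icc 1 T, S.g j t ω) / (T : ℝ) :=
    isBoundedUnder_of ⟨0, fun T => div_nonneg (Finset.sum_nonneg fun t _ =>
      Set.indicator_nonneg (fun _ _ => zero_le_one) _) T.cast_nonneg⟩
  filter_upwards [eventually_lt_of_lt_liminf (((lt_div_iff₀ hp).1 hy).trans_le hg) hbdd,
    hM.eventually_const_lt (sub_neg.2 hxy)] with t hdeliveries hMt
  have hdeliveries : y < 1 / p j * ((∑ l ∈ Finset.Icc 1 t, S.g j l ω) / t) := by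
    rwa [one_div, ← div_eq_inv_mul, lt_div_iff₀ hp]
  rw [M_eq_attempts_sub, sub_div, mul_div_assoc] at hMt
  linarith

-- At most one client is attempted in a slot, so the two rates add up to at most `1`, while by heavy
-- traffic their lower bounds `q 0 / p 0` and `q 1 / p 1` already add up to `1`.
theorem ae_tendsto_attempts_div (hp : ∀ j, 0 < p j) (hpq : q 0 / p 0 + q 1 / p 1 = 1)
    (hful : S.Fulfils q) :
    ∀ᵐ ω ∂P, Tendsto (fun t : ℕ => (S.attempts j t ω : ℝ) / t) atTop (𝓝 (q j / p j)) := by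
  filter_upwards [S.ae_eventually_lt_attempts_div 0 (hp 0) hful,
    S.ae_eventually_lt_attempts_div 1 (hp 1) hful] with ω h0 h1
  have hsum (t : ℕ) : (S.attempts 0 t ω : ℝ) / t + (S.attempts 1 t ω : ℝ) / t ≤ 1 := by
    rw [← add_div]
    exact div_le_one_of_le₀ (by exact_mod_cast S.attempts_add_attempts_le t ω) t.cast_nonneg
  rw [tendsto_order]
  fin_cases j
  · refine ⟨h0, fun x hx => ?_⟩
    simp only [Fin.zero_eta] at hx ⊢
    filter_upwards [h1 (1 - x) (by linarith)] with t ht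
    linarith [hsum t]
  · refine ⟨h1, fun x hx => ?_⟩
    simp only [Fin.mk_one] at hx ⊢
    filter_upwards [h0 (1 - x) (by linarith)] with t ht
    linarith [hsum t]

end AttemptRates

section TimeChange

/-- The event that client `j` is attempted in slot `t + 1`, this being its attempt number `k`, where
attempts are counted from `0`. -/
def attemptAt (S : ScheduledSystem P p) (j : Fin 2) (k t : ℕ) : Set Ω :=
  {ω | S.serve (t + 1) ω = some j ∧ S.attempts j t ω = k}

/-- The event that attempt number `k` of client `j` takes place and its packet is delivered. -/
def attemptSucceeds (S : ScheduledSystem P p) (j : Fin 2) (k : ℕ) : Set Ω :=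
  ⋃ t, S.attemptAt j k t ∩ S.good (t + 1) j

variable {S j}

lemma attempts_succ_of_mem_attemptAt {k t : ℕ} {ω : Ω} (h : ω ∈ S.attemptAt j k t) :
    S.attempts j (t + 1) ω = k + 1 := by
  rw [attempts_succ, if_pos h.1, h.2]

lemma lt_of_mem_attemptAt {i k l t : ℕ} {ω : Ω} (hik : i < k) (hl : ω ∈ S.attemptAt j i l)
    (ht : ω ∈ S.attemptAt j k t) : l < t :=
  (S.attempts_mono j ω).reflect_lt (hl.2.trans_lt (hik.trans_eq ht.2.symm))

lemma le_of_mem_attemptAt {k l t : ℕ} {ω : Ω} (hl : ω ∈ S.attemptAt j k l)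
    (ht : ω ∈ S.attemptAt j k t) : l ≤ t := by
  refine Nat.lt_succ_iff.1 ((S.attempts_mono j ω).reflect_lt ?_)
  simp only [Nat.succ_eq_add_one, attempts_succ_of_mem_attemptAt ht, hl.2, Nat.lt_add_one]

lemma eq_of_mem_attemptAt {k l t : ℕ} {ω : Ω} (hl : ω ∈ S.attemptAt j k l)
    (ht : ω ∈ S.attemptAt j k t) : l = t :=
  le_antisymm (le_of_mem_attemptAt hl ht) (le_of_mem_attemptAt ht hl)

lemma mem_attemptSucceeds_iff {k t : ℕ} {ω : Ω} (h : ω ∈ S.attemptAt j k t) :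
    ω ∈ S.attemptSucceeds j k ↔ ω ∈ S.good (t + 1) j := by
  refine ⟨fun hω => ?_, fun hω => Set.mem_iUnion.2 ⟨t, h, hω⟩⟩
  obtain ⟨l, hl, hl'⟩ := Set.mem_iUnion.1 hω
  rwa [eq_of_mem_attemptAt hl h] at hl'

lemma exists_mem_attemptAt {ω : Ω} {k t : ℕ} (h : k < S.attempts j t ω) :
    ∃ l, ω ∈ S.attemptAt j k l := by
  induction t with
  | zero => simp [attempts_zero] at h
  | succ t ih =>
    by_cases h' : k < S.attempts j t ω
    · exact ih h'
    · rw [attempts_succ] at h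
      split_ifs at h with hs
      · exact ⟨t, hs, by omega⟩
      · omega

lemma exists_attempts_eq {ω : Ω} {n t : ℕ} (h : n ≤ S.attempts j t ω) :
    ∃ l, S.attempts j l ω = n := by
  cases n with
  | zero => exact ⟨0, S.attempts_zero j ω⟩
  | succ n =>
    obtain ⟨l, hl⟩ := exists_mem_attemptAt (Nat.lt_of_succ_le h)
    exact ⟨l + 1, attempts_succ_of_mem_attemptAt hl⟩

lemma frequently_attempts {ω : Ω} (hN : Tendsto (fun t => S.attempts j t ω) atTop atTop)
    {Q : ℕ → Prop} (hQ : ∃ᶠ n in atTop, Q n) : ∃ᶠ t in atTop, Q (S.attempts j t ω) := by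
  refine frequently_atTop.2 fun T => ?_
  obtain ⟨n, hTn, hn⟩ := frequently_atTop.1 hQ T
  obtain ⟨t, ht⟩ := (hN.eventually_ge_atTop n).exists
  obtain ⟨l, rfl⟩ := exists_attempts_eq ht
  exact ⟨l, hTn.trans (S.attempts_le j l ω), hn⟩

lemma tendsto_attempts_atTop {r : ℝ} (hr : 0 < r) {ω : Ω}
    (hN : Tendsto (fun t : ℕ => (S.attempts j t ω : ℝ) / t) atTop (𝓝 r)) :
    Tendsto (fun t => S.attempts j t ω) atTop atTop := by
  rw [← tendsto_natCast_atTop_iff (R := ℝ)]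
  refine (hN.pos_mul_atTop hr tendsto_natCast_atTop_atTop).congr' ?_
  filter_upwards [eventually_ne_atTop 0] with t ht
  exact div_mul_cancel₀ _ (Nat.cast_ne_zero.2 ht)

variable (S j)

lemma M_eq_sum_attemptNoise (t : ℕ) (ω : Ω) :
    S.M j t ω = ∑ k ∈ Finset.range (S.attempts j t ω),
      attemptNoise (p j) (S.attemptSucceeds j k) ω := by
  induction t with
  | zero => simp [attempts_zero, M_zero]
  | succ t ih =>
    rw [M_succ, u_eq_ite, ih]
    by_cases h : S.serve (t + 1) ω = some j
    · have hA : ω ∈ S.attemptAt j (S.attempts j t ω) t := ⟨h, rfl⟩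
      rw [attempts_succ_of_mem_attemptAt hA, Finset.sum_range_succ, if_pos h, one_mul,
        attemptNoise_congr (mem_attemptSucceeds_iff hA)]
    · rw [attempts_succ, if_neg h, if_neg h, zero_mul, add_zero, add_zero]

lemma measurableSet_attemptAt (k t : ℕ) : MeasurableSet[S.ℱ t] (S.attemptAt j k t) :=
  (S.serve_predictable t j).inter (S.measurable_attempts j t (measurableSet_singleton k))

lemma measurableSet_attemptAt_inter_good (k t : ℕ) :
    MeasurableSet[S.ℱ (t + 1)] (S.attemptAt j k t ∩ S.good (t + 1) j) := by
  have hsub : S.attemptAt j k t ⊆ {ω | S.serve (t + 1) ω = some j} := fun ω hω => hω.1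
  rw [← Set.inter_eq_left.2 hsub, Set.inter_assoc]
  exact (S.ℱ.mono t.le_succ _ (S.measurableSet_attemptAt j k t)).inter (S.delivery_observed t j)

lemma measurableSet_attemptSucceeds (k : ℕ) : MeasurableSet (S.attemptSucceeds j k) :=
  MeasurableSet.iUnion fun t => S.ℱ.le (t + 1) _ (S.measurableSet_attemptAt_inter_good j k t)

lemma measurableSet_attemptAt_inter_biInter {k t : ℕ} {s : Finset ℕ} (hs : ∀ i ∈ s, i < k) :
    MeasurableSet[S.ℱ t] (S.attemptAt j k t ∩ ⋂ i ∈ s, S.attemptSucceeds j i) := by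
  have hpast : S.attemptAt j k t ∩ ⋂ i ∈ s, S.attemptSucceeds j i
      = S.attemptAt j k t ∩ ⋂ i ∈ s, ⋃ l ∈ Finset.range t,
        (S.attemptAt j i l ∩ S.good (l + 1) j) := by
    ext ω
    simp only [attemptSucceeds, Set.mem_inter_iff, Set.mem_iInter, Set.mem_iUnion, exists_prop,
      Finset.mem_range]
    refine and_congr_right fun hk => forall₂_congr fun i hi => exists_congr fun l => ?_
    exact ⟨fun h => ⟨lt_of_mem_attemptAt (hs i hi) h.1 hk, h⟩, fun h => h.2⟩
  rw [hpast]
  refine (S.measurableSet_attemptAt j k t).inter (Finset.measurableSet_biInter _ fun i _ =>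
    Finset.measurableSet_biUnion _ fun l hl => ?_)
  exact S.ℱ.mono (Nat.succ_le_of_lt (Finset.mem_range.1 hl)) _
    (S.measurableSet_attemptAt_inter_good j i l)

-- Split by the slot of attempt `k`: in that slot the channel is independent of the past, which
-- decides the outcomes of all earlier attempts.
lemma measure_attemptSucceeds_inter
    (hN : ∀ᵐ ω ∂P, Tendsto (fun t => S.attempts j t ω) atTop atTop) {k : ℕ} {s : Finset ℕ}
    (hs : ∀ i ∈ s, i < k) :
    P (S.attemptSucceeds j k ∩ ⋂ i ∈ s, S.attemptSucceeds j i)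
      = ENNReal.ofReal (p j) * P (⋂ i ∈ s, S.attemptSucceeds j i) := by
  set B := ⋂ i ∈ s, S.attemptSucceeds j i
  have hmeas : ∀ t, MeasurableSet[S.ℱ t] (S.attemptAt j k t ∩ B) := fun t =>
    S.measurableSet_attemptAt_inter_biInter j hs
  have hdisj : Pairwise (Function.onFun Disjoint fun t => S.attemptAt j k t ∩ B) :=
    fun t t' htt => Set.disjoint_left.2 fun ω h h' => htt (eq_of_mem_attemptAt h.1 h'.1)
  have hsucceeds : S.attemptSucceeds j k ∩ B
      = ⋃ t, S.good (t + 1) j ∩ (S.attemptAt j k t ∩ B) := by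
    rw [attemptSucceeds, Set.iUnion_inter]
    refine Set.iUnion_congr fun t => ?_
    rw [Set.inter_comm (S.attemptAt j k t), Set.inter_assoc]
  have hB : P B = P (⋃ t, S.attemptAt j k t ∩ B) := by
    refine measure_congr ?_
    filter_upwards [hN] with ω hω
    obtain ⟨t, ht⟩ := (hω.eventually_gt_atTop k).exists
    obtain ⟨l, hl⟩ := exists_mem_attemptAt ht
    refine propext ⟨fun h => Set.mem_iUnion.2 ⟨l, hl, h⟩, fun h => ?_⟩
    obtain ⟨l, hl⟩ := Set.mem_iUnion.1 h
    exact hl.2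
  rw [hsucceeds, hB, measure_iUnion hdisj fun t => S.ℱ.le t _ (hmeas t),
    measure_iUnion (fun t t' htt => (hdisj htt).mono Set.inter_subset_right Set.inter_subset_right)
      fun t => (S.good_measurable t j).inter (S.ℱ.le t _ (hmeas t)), ← ENNReal.tsum_mul_left]
  exact tsum_congr fun t => by
    rw [(S.good_indep t j _ (hmeas t)).measure_inter_eq_mul, S.good_prob]

variable [IsProbabilityMeasure P]

lemma measure_attemptSucceeds
    (hN : ∀ᵐ ω ∂P, Tendsto (fun t => S.attempts j t ω) atTop atTop) (k : ℕ) :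
    P (S.attemptSucceeds j k) = ENNReal.ofReal (p j) := by
  simpa using S.measure_attemptSucceeds_inter j hN (k := k) (s := ∅) (by simp)

theorem iIndepSet_attemptSucceeds
    (hN : ∀ᵐ ω ∂P, Tendsto (fun t => S.attempts j t ω) atTop atTop) :
    iIndepSet (S.attemptSucceeds j) P := by
  refine iIndepSet_of_forall_lt (S.measurableSet_attemptSucceeds j) fun k s hs => ?_
  rw [S.measure_attemptSucceeds_inter j hN hs, S.measure_attemptSucceeds j hN]

lemma ae_frequently_mul_lilScale_le_sum_attemptNoise (hp : 0 < p j) (hp1 : p j < 1) {a : ℝ}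
    (ha : a < √((1 - p j) / p j))
    (hN : ∀ᵐ ω ∂P, Tendsto (fun t => S.attempts j t ω) atTop atTop) :
    ∀ᵐ ω ∂P, ∃ᶠ n in atTop, a * lilScale n
      ≤ ∑ k ∈ Finset.range n, attemptNoise (p j) (S.attemptSucceeds j k) ω := by
  have hA := S.good_measurable 0 j
  have hPA := S.measureReal_good j hp.le 0
  have hvar := variance_attemptNoise hp.ne' hA hPA
  refine ae_frequently_mul_lilScale_le_sum
    (fun k => measurable_attemptNoise (S.measurableSet_attemptSucceeds j k))
    (iIndepFun_attemptNoise (S.iIndepSet_attemptSucceeds j hN))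
    (fun k => identDistrib_attemptNoise (S.measurableSet_attemptSucceeds j k) hA
      ((S.measure_attemptSucceeds j hN k).trans (S.good_prob 0 j).symm)) ?_
    (integral_attemptNoise hp.ne' hA hPA) ?_ (hvar ▸ ha)
  · simp [integrableExpSet_attemptNoise hA]
  · rw [hvar]
    exact div_pos (sub_pos.2 hp1) hp

theorem ae_frequently_mul_lilScale_le_M (hp : 0 < p j) (hp1 : p j < 1) {r b : ℝ} (hr : 0 < r)
    (hb : b < √(r * ((1 - p j) / p j)))
    (hN : ∀ᵐ ω ∂P, Tendsto (fun t : ℕ => (S.attempts j t ω : ℝ) / t) atTop (𝓝 r)) :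
    ∀ᵐ ω ∂P, ∃ᶠ t : ℕ in atTop, b * lilScale t ≤ S.M j t ω := by
  rw [Real.sqrt_mul hr.le, ← div_lt_iff₀' (Real.sqrt_pos.2 hr)] at hb
  obtain ⟨a, hba, ha⟩ := exists_between hb
  have hN_top := hN.mono fun ω => tendsto_attempts_atTop hr
  filter_upwards [S.ae_frequently_mul_lilScale_le_sum_attemptNoise j hp hp1 ha hN_top, hN,
    hN_top] with ω hsum hω hω_top
  have hratio := (tendsto_lilScale_div_lilScale hr hω).mul_const a
  refine ((frequently_attempts hω_top hsum).and_eventually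
    ((hratio.eventually_const_lt ((div_lt_iff₀' (Real.sqrt_pos.2 hr)).1 hba)).and
      eventually_lilScale_pos)).mono fun t ⟨hsum_t, hratio_t, ht⟩ => ?_
  rw [M_eq_sum_attemptNoise]
  refine le_trans ?_ hsum_t
  rw [← le_div_iff₀ ht, mul_div_assoc, mul_comm a]
  exact hratio_t.le

end TimeChange

section IteratedLogarithm

variable [IsProbabilityMeasure P]

theorem ae_condVarSum_eq (hp : 0 < p j) (T : ℕ) :
    ∀ᵐ ω ∂P, S.condVarSum j T ω = ∑ t ∈ Finset.Icc 1 T, S.u j t ω * ((1 - p j) / p j) := by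
  have h : ∀ᵐ ω ∂P, ∀ t ∈ Finset.Icc 1 T, (P[fun ω' => S.m j t ω' ^ 2 | S.ℱ (t - 1)]) ω
      = S.u j t ω * ((1 - p j) / p j) :=
    (ae_ball_iff (Finset.Icc 1 T).countable_toSet).2 fun t ht =>
      S.condExp_sq_m j hp (Finset.mem_Icc.1 ht).1
  filter_upwards [h] with ω hω
  exact Finset.sum_congr rfl hω

theorem ae_tendsto_condVarSum_div (hp : 0 < p j) {r : ℝ}
    (hN : ∀ᵐ ω ∂P, Tendsto (fun t : ℕ => (S.attempts j t ω : ℝ) / t) atTop (𝓝 r)) :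
    ∀ᵐ ω ∂P, Tendsto (fun T : ℕ => S.condVarSum j T ω / T) atTop
      (𝓝 (r * ((1 - p j) / p j))) := by
  filter_upwards [ae_all_iff.2 (S.ae_condVarSum_eq j hp), hN] with ω hsum hω
  refine (hω.mul_const ((1 - p j) / p j)).congr fun T => ?_
  rw [hsum T, ← Finset.sum_mul, sum_u_eq_attempts, div_mul_eq_mul_div]

lemma ae_eventually_abs_M_le_of_tendsto (hp : 0 < p j) {r b : ℝ} (hr : 0 ≤ r)
    (hN : ∀ᵐ ω ∂P, Tendsto (fun t : ℕ => (S.attempts j t ω : ℝ) / t) atTop (𝓝 r))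
    (hb : √(r * ((1 - p j) / p j)) < b) :
    ∀ᵐ ω ∂P, ∀ᶠ t in atTop, |S.M j t ω| ≤ b * lilScale t := by
  have hcont : Continuous fun a : ℝ => √(a * ((1 - p j) / p j)) := by fun_prop
  obtain ⟨a, hra, hab⟩ := (eventually_mem_nhdsWithin.and
    (((hcont.tendsto r).mono_left nhdsWithin_le_nhds).eventually_lt_const hb :
      ∀ᶠ a in 𝓝[>] r, _)).exists
  filter_upwards [hN, S.ae_eventually_abs_M_le j hp (hr.trans_lt hra) hab] with ω hω hM
  refine hM ?_
  filter_upwards [hω.eventually_lt_const hra, eventually_gt_atTop 0] with t ht ht0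
  exact ((div_lt_iff₀ (Nat.cast_pos.2 ht0)).1 ht).le

theorem ae_limsup_M_div_lilScale (hp : 0 < p j) {r : ℝ}
    (hN : ∀ᵐ ω ∂P, Tendsto (fun t : ℕ => (S.attempts j t ω : ℝ) / t) atTop (𝓝 r)) :
    ∀ᵐ ω ∂P, limsup (fun t : ℕ => ((S.M j t ω / lilScale t : ℝ) : EReal)) atTop
      = ((√(r * ((1 - p j) / p j)) : ℝ) : EReal) := by
  have hp1 : p j ≤ 1 := S.measureReal_good j hp.le 0 ▸ measureReal_le_one
  have hr : 0 ≤ r := by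
    obtain ⟨ω, hω⟩ := hN.exists
    exact ge_of_tendsto' hω fun t => by positivity
  have hv : 0 ≤ (1 - p j) / p j := div_nonneg (sub_nonneg.2 hp1) hp.le
  have habs := fun b => S.ae_eventually_abs_M_le_of_tendsto j hp (b := b) hr hN
  refine ae_limsup_div_eq eventually_lilScale_pos (fun b hb => ?_) fun b hb => ?_
  · filter_upwards [habs b hb] with ω hω
    exact hω.mono fun t => (le_abs_self _).trans
  rcases (mul_nonneg hr hv).eq_or_lt with hzero | hpos
  · rw [← hzero, Real.sqrt_zero] at hb
    filter_upwards [habs (-b) (by rwa [← hzero, Real.sqrt_zero, neg_pos])] with ω hω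
    refine (hω.mono fun t ht => ?_).frequently
    linarith [neg_abs_le (S.M j t ω)]
  · have hp_lt_one : p j < 1 :=
      sub_pos.1 ((div_pos_iff_of_pos_right hp).1 (pos_of_mul_pos_right hpos hr))
    exact S.ae_frequently_mul_lilScale_le_M j hp hp_lt_one (pos_of_mul_pos_left hpos hv) hb hN

end IteratedLogarithm

end ScheduledSystem

theorem mainTheorem8_general {Ω : Type*} [mΩ : MeasurableSpace Ω] (P : Measure Ω)
    [IsProbabilityMeasure P] (p q : Fin 2 → ℝ) (hp : ∀ j, 0 < p j)
    (hpq : q 0 / p 0 + q 1 / p 1 = 1) (S : ScheduledSystem P p) (hful : S.Fulfils q)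
    (j : Fin 2) (v c : ℝ) (hv : v = (1 - p j) / p j) (hc : c = q j * (1 - p j) / p j ^ 2) :
    Martingale (S.M j) S.ℱ P ∧
    (∀ t : ℕ, 1 ≤ t →
      P[fun ω => S.m j t ω ^ 2 | S.ℱ (t - 1)] =ᵐ[P] fun ω => S.u j t ω * v) ∧
    (∀ T : ℕ, ∀ᵐ ω ∂P, S.condVarSum j T ω = ∑ t ∈ Finset.Icc 1 T, S.u j t ω * v) ∧
    (q j / p j * v = c ∧
      ∀ᵐ ω ∂P, Tendsto (fun T : ℕ => S.condVarSum j T ω / (T : ℝ)) atTop (𝓝 c)) ∧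
    (∀ᵐ ω ∂P, Tendsto (fun T : ℕ => √(S.condVarSum j T ω) / √(T : ℝ)) atTop (𝓝 (√c))) ∧
    (∀ᵐ ω ∂P, limsup (fun t : ℕ => ((S.M j t ω / lilScale t : ℝ) : EReal)) atTop
      = ((√c : ℝ) : EReal)) := by
  have hcv : q j / p j * v = c := by
    rw [hv, hc]
    field_simp
  have hN := S.ae_tendsto_attempts_div j hp hpq hful
  have hlim := S.ae_tendsto_condVarSum_div j (hp j) hN
  have hlil := S.ae_limsup_M_div_lilScale j (hp j) hN
  rw [← hv, hcv] at hlim hlil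
  subst hv
  refine ⟨S.martingale_M j (hp j), fun t ht => S.condExp_sq_m j (hp j) ht,
    S.ae_condVarSum_eq j (hp j), ⟨hcv, hlim⟩, hlim.mono fun ω hω => hω.sqrt.congr fun T => ?_, hlil⟩
  rw [Real.sqrt_div' _ T.cast_nonneg]

theorem mainTheorem8 {Ω : Type*} [mΩ : MeasurableSpace Ω] (P : Measure Ω) [IsProbabilityMeasure P]
    (p q : Fin 2 → ℝ) (hp : ∀ j, 0 < p j ∧ p j ≤ 1) (hq : ∀ j, 0 ≤ q j)
    (hpq : q 0 / p 0 + q 1 / p 1 = 1)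
    (S : ScheduledSystem P p) (hidle : S.NonIdling) (hful : S.Fulfils q)
    (j : Fin 2) (v c : ℝ) (hv : v = (1 - p j) / p j) (hc : c = q j * (1 - p j) / p j ^ 2) :
    -- `M_j` is a martingale
    Martingale (S.M j) S.ℱ P ∧
    -- (i)
    (∀ t : ℕ, 1 ≤ t →
      P[fun ω => S.m j t ω ^ 2 | S.ℱ (t - 1)] =ᵐ[P] fun ω => S.u j t ω * v) ∧
    -- (ii)
    (∀ T : ℕ, ∀ᵐ ω ∂P, S.condVarSum j T ω = ∑ t ∈ Finset.Icc 1 T, S.u j t ω * v) ∧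
    -- (iii)
    (q j / p j * v = c ∧
      ∀ᵐ ω ∂P, Tendsto (fun T : ℕ => S.condVarSum j T ω / (T : ℝ)) atTop (𝓝 c)) ∧
    -- (iv)
    (∀ᵐ ω ∂P, Tendsto (fun T : ℕ => Real.sqrt (S.condVarSum j T ω) / Real.sqrt (T : ℝ)) atTop
      (𝓝 (Real.sqrt c))) ∧
    -- the law of the iterated logarithm
    (∀ᵐ ω ∂P, limsup (fun t : ℕ => ((S.M j t ω / lilScale t : ℝ) : EReal)) atTop
      = ((Real.sqrt c : ℝ) : EReal)) :=
  mainTheorem8_general P p q (fun i => (hp i).1) hpq S hful j v c hv hc
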